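/- Let $F$ be a compact (Hausdorff, finite-dimensional, boundaryless) $C^r$-manifold, $r\in\mathbb{N}\cup\{\infty,\omega\}$, and let $\mathrm{Diff}^r(F)$ be its group of $C^r$-diffeomorphisms (homeomorphisms if $r=0$). Let $\Gamma$ be a subgroup of $PSL(2,\mathbb{R})\times \mathrm{Diff}^r(F)$ (for instance of $PSL(2,\mathbb{R})\times \mathrm{Diff}^r_+(F)$ when $F$ is oriented), with projections $p_1:\Gamma\to PSL(2,\mathbb{R})$ and $p_2:\Gamma\to\mathrm{Diff}^r(F)$. Suppose that the action $(\gamma_1,\gamma_2)(z,y)=(\gamma_1(z),\gamma_2(y))$ of $\Gamma$ on $\mathbb{H}\times F$, where $\mathbb{H}$ is the upper half-plane on which $PSL(2,\mathbb{R})$ acts by homographies, is free and properly discontinuous with compact quotient $M=\Gamma\backslash(\mathbb{H}\times F)$, and that the foliation of $M$ induced by the horizontal foliation of $\mathbb{H}\times F$ is minimal, that is, for every $y\in F$ the image of $\mathbb{H}\times\{y\}$ is dense in $M$. Assume that $\Gamma$ is torsion-free and that $p_1(\Gamma)$ is not solvable. If $p_2:\Gamma\to\mathrm{Diff}^r(F)$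 is not injective, then the right action $\Gamma(f,y)\cdot u=\Gamma(fu,y)$ of $$U=\Big\{\pm\begin{pmatrix}1&t\\0&1\end{pmatrix} : t\in\mathbb{R}\Big\}\subset PSL(2,\mathbb{R})$$ on $X=\Gamma\backslash(PSL(2,\mathbb{R})\times F)$, where $\Gamma$ acts by $(\gamma_1,\gamma_2)(f,y)=(\gamma_1f,\gamma_2(y))$, is minimal: every $U$-orbit is dense in $X$. -/

import Mathlib

open scoped MatrixGroups Manifold ContDiff UpperHalfPlane

namespace HorocycleFoliation

/-! ### The action of `PSL(2, ℝ)` on the upper half-plane by homographies -/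

/-- `PSL(2, ℝ)` acts on `ℍ` through its inclusion in `PGL(2, ℝ)`. -/
noncomputable instance pslAction : MulAction PSL(2, ℝ) ℍ :=
  MulAction.compHom ℍ (Matrix.ProjectiveSpecialLinearGroup.toPGL (n := Fin 2) (R := ℝ))

/-- The class of a matrix `g` acts as `z ↦ (a z + b) / (c z + d)`. -/
theorem coe_psl_smul (g : SL(2, ℝ)) (z : ℍ) :
    (((QuotientGroup.mk g : PSL(2, ℝ)) • z : ℍ) : ℂ) =
      ((g 0 0 : ℂ) * z + (g 0 1 : ℂ)) / ((g 1 0 : ℂ) * z + (g 1 1 : ℂ)) :=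
  UpperHalfPlane.coe_specialLinearGroup_apply g z

/-! ### The group of `C^r`-diffeomorphisms of a manifold -/

section Diff

variable {n : ℕ} {r : WithTop ℕ∞} {F : Type*} [TopologicalSpace F]
  [ChartedSpace (EuclideanSpace ℝ (Fin n)) F]

/-- The group of `C^r`-diffeomorphisms of `F` (homeomorphisms for `r = 0`), under composition. -/
noncomputable instance diffGroup : Group (F ≃ₘ^r⟮𝓡 n, 𝓡 n⟯ F) where
  mul f g := g.trans f
  one := Diffeomorph.refl (𝓡 n) F r
  inv f := f.symm
  mul_assoc _ _ _ := rfl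
  one_mul _ := rfl
  mul_one _ := rfl
  inv_mul_cancel f := Diffeomorph.ext fun x => f.toEquiv.symm_apply_apply x

/-- The tautological action of the diffeomorphism group on the manifold. -/
noncomputable instance diffAction : MulAction (F ≃ₘ^r⟮𝓡 n, 𝓡 n⟯ F) F where
  smul f x := f x
  one_smul _ := rfl
  mul_smul _ _ _ := rfl

end Diff

/-! ### Componentwise actions -/

/-- If `G` acts on `Y` and `D` acts on `Z`, then `G × D` acts on `Y × Z` by
`(g, d) • (y, z) = (g • y, d • z)`. -/
instance componentwiseAction {G D Y Z : Type*} [Monoid G] [Monoid D]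
    [MulAction G Y] [MulAction D Z] : MulAction (G × D) (Y × Z) where
  smul g x := (g.1 • x.1, g.2 • x.2)
  one_smul x := Prod.ext (one_smul G x.1) (one_smul D x.2)
  mul_smul g h x := Prod.ext (mul_smul g.1 h.1 x.1) (mul_smul g.2 h.2 x.2)

/-- The subgroup `U` of `PSL(2, ℝ)` of the classes of the matrices `(1 t; 0 1)`, `t ∈ ℝ`. -/
def horocyclicSubgroup : Subgroup PSL(2, ℝ) where
  carrier := {u | ∃ (g : SL(2, ℝ)) (t : ℝ),
    (g : Matrix (Fin 2) (Fin 2) ℝ) = !![1, t; 0, 1] ∧ (QuotientGroup.mk g : PSL(2, ℝ)) = u}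
  one_mem' := ⟨1, 0, by simp [Matrix.one_fin_two], rfl⟩
  mul_mem' := by
    rintro _ _ ⟨g, s, hg, rfl⟩ ⟨h, t, hh, rfl⟩
    exact ⟨g * h, t + s, by simp [hg, hh], rfl⟩
  inv_mem' := by
    rintro _ ⟨g, s, hg, rfl⟩
    exact ⟨g⁻¹, -s, by simp [Matrix.SpecialLinearGroup.coe_inv, hg, Matrix.adjugate_fin_two], rfl⟩

section Quotients

variable {n : ℕ} {r : WithTop ℕ∞} {F : Type*} [TopologicalSpace F]
  [ChartedSpace (EuclideanSpace ℝ (Fin n)) F]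
  (Γ : Subgroup (PSL(2, ℝ) × (F ≃ₘ^r⟮𝓡 n, 𝓡 n⟯ F)))

/-- `M = Γ \ (ℍ × F)`, with the quotient topology. -/
abbrev FoliatedSpace : Type _ := MulAction.orbitRel.Quotient Γ (ℍ × F)

/-- `X = Γ \ (PSL(2, ℝ) × F)`, with the quotient topology. -/
abbrev UnitTangentSpace : Type _ := MulAction.orbitRel.Quotient Γ (PSL(2, ℝ) × F)

/-- The leaf through `Γ (z, y)`, for any `z`, of the foliation of `M` induced by the horizontal
foliation of `ℍ × F`: the image of `ℍ × {y}`. -/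
def leaf (y : F) : Set (FoliatedSpace Γ) :=
  Set.range fun z : ℍ => (Quotient.mk'' (z, y) : FoliatedSpace Γ)

/-- The foliation of `M` is minimal: all its leaves are dense. -/
def IsMinimalFoliation : Prop := ∀ y : F, Dense (leaf Γ y)

/-- The right action `Γ (f, y) · f' = Γ (f f', y)` of `PSL(2, ℝ)` on `X`, written as an action of
the opposite group. -/
noncomputable instance rightAction : MulAction PSL(2, ℝ)ᵐᵒᵖ (UnitTangentSpace Γ) where
  smul a := Quotient.map (sa := MulAction.orbitRel Γ _) (sb := MulAction.orbitRel Γ _) (fun x : PSL(2, ℝ) × F => (x.1 * a.unop, x.2)) (by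
    rintro _ x ⟨γ, rfl⟩
    exact ⟨γ, Prod.ext (mul_assoc _ _ _).symm rfl⟩)
  one_smul := by
    rintro ⟨x⟩
    exact congrArg (Quotient.mk'' : _ → UnitTangentSpace Γ)
      (Prod.ext (mul_one x.1) rfl : (x.1 * 1, x.2) = x)
  mul_smul := by
    rintro a b ⟨x⟩
    exact congrArg (Quotient.mk'' : _ → UnitTangentSpace Γ)
      (Prod.ext (mul_assoc x.1 b.unop a.unop).symm rfl :
        (x.1 * (b.unop * a.unop), x.2) = (x.1 * b.unop * a.unop, x.2))

end Quotients

end HorocycleFoliation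

open Set Filter Topology

namespace HorocycleFoliation

/-! ### Closed subsets of the line stable under translations -/

/-! Taking first columns identifies `PSL(2, ℝ) / U` with the nonzero vectors of the plane up to
sign. A nonempty closed `U`-stable subset of `X` therefore becomes a closed subset `E'` of (ℝ² ∖ 0)
× `F`, stable under `Γ` acting linearly on the first factor. The claim is that `E'` is everything.

Let Λ and `N` be the preimages in `SL(2, ℝ)` of p₁(Γ) and of the kernel of p₂ (`liftFst`,
`liftKer`). Compactness of `M` makes Λ cocompact, though perhaps not discrete. `N` is normal in Λ;
proper discontinuity makes it discrete, freeness excludes elliptic elements, and it exceeds ±1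
because p₂ is not injective. Conjugation by Λ would bring a parabolic element of `N` arbitrarily
close to 1, so `N` has none and contains a hyperbolic h, which may be taken to be diag(a, a⁻¹).

Two facts carry the proof. A closed Λ-stable set with a nonzero vector contains a nonzero
eigenvector of h on the expanding axis (`exists_fst_axis_mem`). A closed `N`-stable set containing
such an eigenvector is the whole plane (`eq_univ_of_fst_axis_mem`): it contains the axis, because
multiplication by the entries `g 0 0`, g in `N`, moves points along it densely (`fst_axis_mem`), and
then every line, because the limit set of `N` is the whole circle (`eq_univ_of_smul_mem`).

Since `F` is compact, `E'` has closed projection to the punctured plane, so some (w, y) in `E'` has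
w such an eigenvector. The fibre over y is `N`-stable because `N` acts trivially on `F`, hence it is
full. The Γ-orbit of y is dense by minimality of the foliation, so `E'` is everything. -/

theorem exists_int_nat_abs_sub_lt {l d : ℝ} (hl : 0 < l) (hd : 0 < d) (y : ℝ) :
    ∃ (i : ℤ) (j : ℕ), (j : ℝ) * d ≤ l ∧ |y - i * l - j * d| < d := by
  have h1 := Int.floor_le (y / l)
  have h2 := Int.lt_floor_add_one (y / l)
  rw [le_div_iff₀ hl] at h1
  rw [div_lt_iff₀ hl] at h2
  have h0 : 0 ≤ (y - ⌊y / l⌋ * l) / d := div_nonneg (by linarith) hd.le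
  have h3 := Nat.floor_le h0
  have h4 := Nat.lt_floor_add_one ((y - ⌊y / l⌋ * l) / d)
  rw [le_div_iff₀ hd] at h3
  rw [div_lt_iff₀ hd] at h4
  refine ⟨⌊y / l⌋, ⌊(y - ⌊y / l⌋ * l) / d⌋₊, by linarith, ?_⟩
  rw [abs_of_nonneg (by linarith)]
  linarith

theorem exists_int_nat_abs_sub_lt_abs {l d : ℝ} (hl : 0 < l) (hd : d ≠ 0) (y : ℝ) :
    ∃ (i : ℤ) (j : ℕ), (j : ℝ) * |d| ≤ l ∧ |y - i * l - j * d| < |d| := by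
  rcases hd.lt_or_gt with h | h
  · obtain ⟨i, j, h1, h2⟩ := exists_int_nat_abs_sub_lt hl (neg_pos.2 h) (-y)
    refine ⟨-i, j, by rwa [abs_of_neg h], ?_⟩
    rw [abs_of_neg h, ← abs_neg]
    convert h2 using 2
    push_cast
    ring
  · obtain ⟨i, j, h1, h2⟩ := exists_int_nat_abs_sub_lt hl h y
    exact ⟨i, j, by rwa [abs_of_pos h], by rwa [abs_of_pos h]⟩

/-- A closed set of reals that is stable under `± l`, under `c` and under `c + d` for arbitrarily
small nonzero `d`, is empty or the whole line. -/
theorem eq_univ_of_add_mem {S : Set ℝ} (hS : IsClosed S) (h0 : (0 : ℝ) ∈ S) {l c : ℝ} (hl : 0 < l)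
    (hadd : ∀ x ∈ S, x + l ∈ S) (hsub : ∀ x ∈ S, x - l ∈ S) (hc : ∀ x ∈ S, x + c ∈ S)
    (hd : ∀ ε > 0, ∃ d : ℝ, d ≠ 0 ∧ |d| < ε ∧ ∀ x ∈ S, x + (c + d) ∈ S) : S = univ := by
  have hnat : ∀ {a : ℝ}, (∀ x ∈ S, x + a ∈ S) → ∀ (k : ℕ), ∀ x ∈ S, x + k * a ∈ S := by
    intro a ha k
    induction k with
    | zero => intro x hx; simpa using hx
    | succ k ih =>
      intro x hx
      have := ha _ (ih x hx)
      convert this using 1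
      push_cast; ring
  have hint : ∀ (i : ℤ), ∀ x ∈ S, x + i * l ∈ S := by
    intro i x hx
    obtain ⟨k, rfl | rfl⟩ := i.eq_nat_or_neg
    · simpa using hnat hadd k x hx
    · have := hnat (a := -l) (fun x hx => by simpa [sub_eq_add_neg] using hsub x hx) k x hx
      convert this using 1
      push_cast; ring
  refine eq_univ_of_forall fun T => hS.closure_eq ▸ Metric.mem_closure_iff.2 fun ε hε => ?_
  obtain ⟨d, hd0, hdε, hdS⟩ := hd ε hε
  have hdp := abs_pos.2 hd0
  -- Only nonnegative multiples of c and c + d are available, so their total number is fixed at n: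
  -- (n - j) c + j (c + d) = n c + j d, and j d for j ≤ n sweeps a period l in steps |d|.
  obtain ⟨n, hn⟩ := exists_nat_ge (l / |d|)
  rw [div_le_iff₀ hdp] at hn
  obtain ⟨i, j, hj, hij⟩ := exists_int_nat_abs_sub_lt_abs hl hd0 (T - n * c)
  have hjn : j ≤ n := by
    have : (j : ℝ) ≤ n := le_of_mul_le_mul_right (hj.trans hn) hdp
    exact_mod_cast this
  refine ⟨_, hint i _ (hnat hdS j _ (hnat hc (n - j) 0 h0)), ?_⟩
  rw [Real.dist_eq, Nat.cast_sub hjn]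
  refine lt_trans (lt_of_eq_of_lt ?_ hij) hdε
  congr 1
  ring

/-! ### The linear action of `SL(2, ℝ)` on the plane -/

/-- The linear action of `SL(2, ℝ)` on column vectors. -/
def linAct (g : SL(2, ℝ)) (v : ℝ × ℝ) : ℝ × ℝ :=
  (g 0 0 * v.1 + g 0 1 * v.2, g 1 0 * v.1 + g 1 1 * v.2)

theorem sl_det (g : SL(2, ℝ)) : g 0 0 * g 1 1 - g 0 1 * g 1 0 = 1 := by
  rw [← Matrix.det_fin_two]
  exact g.2

theorem sl_mul_apply (g h : SL(2, ℝ)) (i j : Fin 2) :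
    (g * h) i j = g i 0 * h 0 j + g i 1 * h 1 j := by
  rw [Matrix.SpecialLinearGroup.coe_mul, Matrix.mul_apply, Fin.sum_univ_two]

theorem sl_inv_apply (g : SL(2, ℝ)) : g⁻¹ 0 0 = g 1 1 ∧ g⁻¹ 0 1 = -g 0 1 ∧ g⁻¹ 1 0 = -g 1 0 ∧
    g⁻¹ 1 1 = g 0 0 := by
  simp [Matrix.SpecialLinearGroup.coe_inv, Matrix.adjugate_fin_two]

theorem sl_ext {g h : SL(2, ℝ)} (h00 : g 0 0 = h 0 0) (h01 : g 0 1 = h 0 1) (h10 : g 1 0 = h 1 0)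
    (h11 : g 1 1 = h 1 1) : g = h := by
  ext i j
  fin_cases i <;> fin_cases j <;> assumption

theorem sl_one_apply : (1 : SL(2, ℝ)) 0 0 = 1 ∧ (1 : SL(2, ℝ)) 0 1 = 0 ∧ (1 : SL(2, ℝ)) 1 0 = 0 ∧
    (1 : SL(2, ℝ)) 1 1 = 1 := by
  simp

theorem linAct_mul (g h : SL(2, ℝ)) (v : ℝ × ℝ) : linAct (g * h) v = linAct g (linAct h v) := by
  simp only [linAct, sl_mul_apply, Prod.mk.injEq]
  constructor <;> ring

theorem linAct_one (v : ℝ × ℝ) : linAct 1 v = v := by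
  simp [linAct]

theorem linAct_inv_linAct (g : SL(2, ℝ)) (v : ℝ × ℝ) : linAct g⁻¹ (linAct g v) = v := by
  rw [← linAct_mul, inv_mul_cancel, linAct_one]

theorem linAct_linAct_inv (g : SL(2, ℝ)) (v : ℝ × ℝ) : linAct g (linAct g⁻¹ v) = v := by
  rw [← linAct_mul, mul_inv_cancel, linAct_one]

theorem linAct_smul (g : SL(2, ℝ)) (t : ℝ) (v : ℝ × ℝ) : linAct g (t • v) = t • linAct g v := by
  simp only [linAct, Prod.smul_fst, Prod.smul_snd, smul_eq_mul, Prod.smul_mk, Prod.mk.injEq]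
  constructor <;> ring

theorem linAct_zero (g : SL(2, ℝ)) : linAct g 0 = 0 := by
  simp [linAct]

theorem linAct_ne_zero (g : SL(2, ℝ)) {v : ℝ × ℝ} (hv : v ≠ 0) : linAct g v ≠ 0 := fun h =>
  hv (by rw [← linAct_inv_linAct g v, h, linAct_zero])

theorem continuous_linAct (g : SL(2, ℝ)) : Continuous (linAct g) := by
  unfold linAct
  fun_prop

/-- The diagonal matrix with entries `a` and `a⁻¹`. -/
noncomputable def diagMat (a : ℝ) (ha : a ≠ 0) : SL(2, ℝ) :=
  ⟨!![a, 0; 0, a⁻¹], by simp [Matrix.det_fin_two, ha]⟩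

theorem diagMat_apply (a : ℝ) (ha : a ≠ 0) : diagMat a ha 0 0 = a ∧ diagMat a ha 0 1 = 0 ∧
    diagMat a ha 1 0 = 0 ∧ diagMat a ha 1 1 = a⁻¹ := by
  simp [diagMat]

theorem linAct_diagMat (a : ℝ) (ha : a ≠ 0) (v : ℝ × ℝ) :
    linAct (diagMat a ha) v = (a * v.1, a⁻¹ * v.2) := by
  simp [linAct, diagMat]

/-- A matrix of determinant one whose first column is `v ≠ 0`, depending continuously on `v`. -/
noncomputable def colMat (v : ℝ × ℝ) (hv : v ≠ 0) : SL(2, ℝ) :=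
  ⟨!![v.1, -v.2 / (v.1 ^ 2 + v.2 ^ 2); v.2, v.1 / (v.1 ^ 2 + v.2 ^ 2)], by
    have : v.1 ^ 2 + v.2 ^ 2 ≠ 0 := fun h => hv (Prod.ext (by simp; nlinarith) (by simp; nlinarith))
    rw [Matrix.det_fin_two_of]
    field_simp
    ring⟩

theorem colMat_apply (v : ℝ × ℝ) (hv : v ≠ 0) : colMat v hv 0 0 = v.1 ∧ colMat v hv 1 0 = v.2 := by
  simp [colMat]

theorem linAct_colMat (v : ℝ × ℝ) (hv : v ≠ 0) : linAct (colMat v hv) (1, 0) = v := by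
  simp [linAct, colMat]

/-! ### Cocompact groups with a discrete normal subgroup -/

/-- `Λ` is cocompact, and `N` is a discrete normal subgroup of it without elliptic elements. -/
structure CocompactNormalPair (Λ N : Subgroup SL(2, ℝ)) : Prop where
  bounded : ∃ R : ℝ, ∀ f : SL(2, ℝ), ∃ γ ∈ Λ, ∀ i j, |(γ * f) i j| ≤ R
  le : N ≤ Λ
  normal : ∀ γ ∈ Λ, ∀ g ∈ N, γ * g * γ⁻¹ ∈ N
  discrete : ∃ ε > 0, ∀ g ∈ N, (∀ i j, |g i j - (1 : SL(2, ℝ)) i j| < ε) → g = 1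
  two_le_abs_trace : ∀ g ∈ N, 2 ≤ |g 0 0 + g 1 1|
  neg_one_mem : -1 ∈ N

theorem abs_mul_apply_le {g h : SL(2, ℝ)} {A B : ℝ} (hg : ∀ i j, |g i j| ≤ A)
    (hh : ∀ i j, |h i j| ≤ B) (i j : Fin 2) : |(g * h) i j| ≤ 2 * (A * B) := by
  have hA : 0 ≤ A := (abs_nonneg _).trans (hg 0 0)
  rw [sl_mul_apply]
  calc _ ≤ |g i 0 * h 0 j| + |g i 1 * h 1 j| := abs_add_le _ _
    _ = |g i 0| * |h 0 j| + |g i 1| * |h 1 j| := by rw [abs_mul, abs_mul]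
    _ ≤ A * B + A * B := by gcongr <;> first | exact hg _ _ | exact hh _ _
    _ = _ := by ring

theorem exists_abs_apply_le (g : SL(2, ℝ)) : ∃ A : ℝ, 0 < A ∧ ∀ i j, |g i j| ≤ A := by
  have h : ∀ i j : Fin 2, 0 ≤ |g i j| := fun i j => abs_nonneg _
  refine ⟨|g 0 0| + |g 0 1| + |g 1 0| + |g 1 1| + 1, ?_, fun i j => ?_⟩
  · linarith [h 0 0, h 0 1, h 1 0, h 1 1]
  · fin_cases i <;> fin_cases j <;> simp only [Fin.zero_eta, Fin.mk_one] <;>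
      linarith [h 0 0, h 0 1, h 1 0, h 1 1]

/-- If `g` is entrywise close to `1` then so is `P g P⁻¹`. -/
theorem abs_conj_sub_one_le {P g : SL(2, ℝ)} {A δ : ℝ} (hP : ∀ i j, |P i j| ≤ A)
    (hg : ∀ i j, |g i j - (1 : SL(2, ℝ)) i j| ≤ δ) (i j : Fin 2) :
    |(P * g * P⁻¹) i j - (1 : SL(2, ℝ)) i j| ≤ 4 * A ^ 2 * δ := by
  have hA : 0 ≤ A := (abs_nonneg _).trans (hP 0 0)
  have hPinv : ∀ i j, |P⁻¹ i j| ≤ A := by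
    obtain ⟨h1, h2, h3, h4⟩ := sl_inv_apply P
    intro i j
    fin_cases i <;> fin_cases j <;> simp only [Fin.zero_eta, Fin.mk_one, h1, h2, h3, h4, abs_neg] <;>
      exact hP _ _
  have key : (P * g * P⁻¹) i j - (1 : SL(2, ℝ)) i j =
      ∑ k, ∑ l, P i k * (g k l - (1 : SL(2, ℝ)) k l) * P⁻¹ l j := by
    have h1 : (1 : SL(2, ℝ)) i j = (P * 1 * P⁻¹) i j := by simp
    rw [h1]
    simp only [sl_mul_apply, Fin.sum_univ_two]
    ring
  rw [key]
  calc _ ≤ ∑ k : Fin 2, ∑ l : Fin 2, |P i k * (g k l - (1 : SL(2, ℝ)) k l) * P⁻¹ l j| :=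
        (Finset.abs_sum_le_sum_abs _ _).trans
          (Finset.sum_le_sum fun k _ => Finset.abs_sum_le_sum_abs _ _)
    _ ≤ ∑ k : Fin 2, ∑ l : Fin 2, A * δ * A := by
        refine Finset.sum_le_sum fun k _ => Finset.sum_le_sum fun l _ => ?_
        rw [abs_mul, abs_mul]
        gcongr
        · exact mul_nonneg hA ((abs_nonneg _).trans (hg k l))
        · exact hP _ _
        · exact hg _ _
        · exact hPinv _ _
    _ = _ := by simp; ring

theorem CocompactNormalPair.conj {Λ N : Subgroup SL(2, ℝ)} (H : CocompactNormalPair Λ N)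
    (P : SL(2, ℝ)) : CocompactNormalPair (Λ.comap (MulAut.conj P).toMonoidHom)
      (N.comap (MulAut.conj P).toMonoidHom) where
  bounded := by
    obtain ⟨R, hR⟩ := H.bounded
    obtain ⟨A, -, hA⟩ := exists_abs_apply_le P⁻¹
    refine ⟨2 * (A * R), fun f => ?_⟩
    obtain ⟨γ, hγ, hb⟩ := hR (P * f)
    refine ⟨P⁻¹ * γ * P, by simpa [mul_assoc] using hγ, fun i j => ?_⟩
    have := abs_mul_apply_le hA hb i j
    convert this using 3
    simp only [mul_assoc]
  le := Subgroup.comap_mono H.le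
  normal γ hγ g hg := by
    have := H.normal _ hγ _ hg
    simpa [mul_assoc] using this
  discrete := by
    obtain ⟨ε, hε, hd⟩ := H.discrete
    obtain ⟨A, hA0, hA⟩ := exists_abs_apply_le P
    refine ⟨ε / (8 * A ^ 2), by positivity, fun g hg hgε => ?_⟩
    have h1 := hd _ hg fun i j => (abs_conj_sub_one_le hA (fun i j => (hgε i j).le) i j).trans_lt
      (by field_simp; linarith)
    simpa using h1
  two_le_abs_trace g hg := by
    have := H.two_le_abs_trace _ hg
    convert this using 2
    obtain ⟨h1, h2, h3, h4⟩ := sl_inv_apply P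
    simp only [MulEquiv.coe_toMonoidHom, MulAut.conj_apply, sl_mul_apply, h1, h2, h3, h4]
    linear_combination -(g 0 0 + g 1 1) * sl_det P
  neg_one_mem := by
    have : P * (-1 : SL(2, ℝ)) * P⁻¹ = -1 := by simp
    simpa [Subgroup.mem_comap] using H.neg_one_mem

/-! ### Eigenvectors and diagonalisation in `SL(2, ℝ)` -/

theorem diagMat_inv (a : ℝ) (ha : a ≠ 0) : (diagMat a ha)⁻¹ = diagMat a⁻¹ (inv_ne_zero ha) := by
  obtain ⟨h1, h2, h3, h4⟩ := sl_inv_apply (diagMat a ha)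
  obtain ⟨k1, k2, k3, k4⟩ := diagMat_apply a ha
  obtain ⟨l1, l2, l3, l4⟩ := diagMat_apply a⁻¹ (inv_ne_zero ha)
  apply sl_ext <;> simp [*]

theorem diagMat_pow (a : ℝ) (ha : a ≠ 0) (m : ℕ) :
    diagMat a ha ^ m = diagMat (a ^ m) (pow_ne_zero m ha) := by
  induction m with
  | zero =>
    obtain ⟨l1, l2, l3, l4⟩ := diagMat_apply (a ^ 0) (pow_ne_zero 0 ha)
    apply sl_ext <;> simp only [l1, l2, l3, l4] <;> simp
  | succ m ih =>
    rw [pow_succ, ih]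
    obtain ⟨k1, k2, k3, k4⟩ := diagMat_apply a ha
    obtain ⟨l1, l2, l3, l4⟩ := diagMat_apply (a ^ m) (pow_ne_zero m ha)
    obtain ⟨m1, m2, m3, m4⟩ := diagMat_apply (a ^ (m + 1)) (pow_ne_zero (m + 1) ha)
    apply sl_ext <;> simp only [sl_mul_apply, *] <;> simp [pow_succ, mul_comm]

/-- By the characteristic equation, (g₀₁, μ - g₀₀) and (μ - g₁₁, g₁₀) both lie in the kernel of g -
μ; if both vanish, g is scalar. -/
theorem exists_eigenvector (g : SL(2, ℝ)) {μ : ℝ} (hμ : μ ^ 2 - (g 0 0 + g 1 1) * μ + 1 = 0) :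
    ∃ v : ℝ × ℝ, v ≠ 0 ∧ linAct g v = μ • v := by
  have hdet := sl_det g
  by_cases h1 : ((g 0 1, μ - g 0 0) : ℝ × ℝ) = 0
  · by_cases h2 : ((μ - g 1 1, g 1 0) : ℝ × ℝ) = 0
    · simp only [Prod.mk_eq_zero] at h1 h2
      refine ⟨(1, 0), by simp, ?_⟩
      ext <;> simp [linAct, h2.2]
      linarith [h1.2]
    · refine ⟨_, h2, ?_⟩
      ext <;> simp only [linAct, Prod.smul_mk, smul_eq_mul]
      · linear_combination (-1 : ℝ) * hμ - hdet
      · ring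
  · refine ⟨_, h1, ?_⟩
    ext <;> simp only [linAct, Prod.smul_mk, smul_eq_mul]
    · ring
    · linear_combination (-1 : ℝ) * hμ - hdet

/-- Conjugating by a matrix whose first column is an eigenvector makes `g` upper triangular. -/
theorem colMat_conj_apply (g : SL(2, ℝ)) {μ : ℝ} {v : ℝ × ℝ} (hv : v ≠ 0)
    (hg : linAct g v = μ • v) :
    ((colMat v hv)⁻¹ * g * colMat v hv) 0 0 = μ ∧ ((colMat v hv)⁻¹ * g * colMat v hv) 1 0 = 0 := by
  have h : linAct ((colMat v hv)⁻¹ * g * colMat v hv) (1, 0) = μ • (1, 0) := by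
    rw [linAct_mul, linAct_mul, linAct_colMat, hg, linAct_smul]
    congr 1
    exact (congrArg (linAct _) (linAct_colMat v hv).symm).trans (linAct_inv_linAct _ _)
  simpa [linAct] using h

/-- The unipotent upper triangular matrices. -/
def unipMat (t : ℝ) : SL(2, ℝ) := ⟨!![1, t; 0, 1], by simp [Matrix.det_fin_two]⟩

theorem unipMat_apply (t : ℝ) : unipMat t 0 0 = 1 ∧ unipMat t 0 1 = t ∧ unipMat t 1 0 = 0 ∧
    unipMat t 1 1 = 1 := by
  simp [unipMat]

theorem exists_conj_eq_diagMat (g : SL(2, ℝ)) (hg : 2 < g 0 0 + g 1 1) :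
    ∃ (P : SL(2, ℝ)) (a : ℝ) (ha : 1 < a),
      P⁻¹ * g * P = diagMat a (zero_lt_one.trans ha).ne' := by
  set τ := g 0 0 + g 1 1 with hτ
  have hs : √(τ ^ 2 - 4) ^ 2 = τ ^ 2 - 4 := Real.sq_sqrt (by nlinarith)
  have hs0 := Real.sqrt_nonneg (τ ^ 2 - 4)
  set a := (τ + √(τ ^ 2 - 4)) / 2 with ha
  have ha1 : 1 < a := by linarith
  have ha0 : a ≠ 0 := (zero_lt_one.trans ha1).ne'
  obtain ⟨v, hv, hgv⟩ := exists_eigenvector g (μ := a) (by rw [← hτ, ha]; linear_combination hs / 4)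
  obtain ⟨h1, h2⟩ := colMat_conj_apply g hv hgv
  set u := (colMat v hv)⁻¹ * g * colMat v hv with hu
  have h3 : u 1 1 = a⁻¹ := by
    have := sl_det u
    rw [h1, h2] at this
    field_simp
    linarith
  have hne : a - a⁻¹ ≠ 0 := by
    have : a⁻¹ < 1 := inv_lt_one_of_one_lt₀ ha1
    linarith
  -- Conjugating the triangular u by `unipMat x` adds x (a - a⁻¹) to its upper right entry.
  set x := -u 0 1 / (a - a⁻¹) with hx
  have hxe : x * (a - a⁻¹) = -u 0 1 := div_mul_cancel₀ _ hne
  refine ⟨colMat v hv * unipMat x, a, ha1, ?_⟩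
  have : (colMat v hv * unipMat x)⁻¹ * g * (colMat v hv * unipMat x) =
      (unipMat x)⁻¹ * u * unipMat x := by
    rw [hu]; group
  rw [this]
  obtain ⟨k1, k2, k3, k4⟩ := unipMat_apply x
  obtain ⟨l1, l2, l3, l4⟩ := sl_inv_apply (unipMat x)
  obtain ⟨m1, m2, m3, m4⟩ := diagMat_apply a ha0
  apply sl_ext <;> simp only [sl_mul_apply, k1, k2, k3, k4, l1, l2, l3, l4, m1, m2, m3, m4, h1, h2,
    h3]
  · ring
  · linear_combination hxe
  · ring
  · ring

theorem tendsto_inv_pow_sq {a : ℝ} (ha : 1 < a) : Tendsto (fun m : ℕ => ((a ^ m)⁻¹) ^ 2) atTop (𝓝 0) := by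
  have h : Tendsto (fun m : ℕ => (a ^ m)⁻¹) atTop (𝓝 0) :=
    (tendsto_pow_atTop_atTop_of_one_lt ha).inv_tendsto_atTop
  simpa using h.pow 2

/-! ### Parabolic and hyperbolic elements of the normal subgroup -/

namespace CocompactNormalPair

variable {Λ N : Subgroup SL(2, ℝ)}

/-- The orbits of a cocompact group accumulate at the origin. -/
theorem exists_linAct_small (H : CocompactNormalPair Λ N) (v : ℝ × ℝ) {ε : ℝ} (hε : 0 < ε) :
    ∃ γ ∈ Λ, |(linAct γ v).1| < ε ∧ |(linAct γ v).2| < ε := by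
  rcases eq_or_ne v 0 with rfl | hv
  · exact ⟨1, Λ.one_mem, by simpa [linAct] using hε⟩
  obtain ⟨R, hR⟩ := H.bounded
  have hR0 : 0 ≤ R := by
    obtain ⟨γ, -, h⟩ := hR 1
    exact (abs_nonneg _).trans (h 0 0)
  -- With this scale s, the first column of γ f diag(s, s⁻¹) is s γv; it is bounded by R, so γv has
  -- entries below ε.
  have hs : 0 < (R + 1) / ε := by positivity
  obtain ⟨γ, hγ, h⟩ := hR (colMat v hv * diagMat _ hs.ne')
  obtain ⟨k1, k2, k3, k4⟩ := diagMat_apply _ hs.ne'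
  obtain ⟨c1, c2⟩ := colMat_apply v hv
  have key : ∀ i, |γ i 0 * v.1 + γ i 1 * v.2| < ε := by
    intro i
    have h0 := h i 0
    have : (γ * (colMat v hv * diagMat _ hs.ne')) i 0 =
        (γ i 0 * v.1 + γ i 1 * v.2) * ((R + 1) / ε) := by
      simp only [sl_mul_apply, k1, k3, c1, c2]
      ring
    rw [this, abs_mul, abs_of_pos hs] at h0
    by_contra! hcon
    have : ε * ((R + 1) / ε) ≤ R := (mul_le_mul_of_nonneg_right hcon hs.le).trans h0
    rw [mul_div_cancel₀ _ hε.ne'] at this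
    linarith
  exact ⟨γ, hγ, key 0, key 1⟩

/-- The normal subgroup contains no parabolic elements. -/
theorem eq_one_of_trace_eq_two (H : CocompactNormalPair Λ N) {g : SL(2, ℝ)} (hg : g ∈ N)
    (htr : g 0 0 + g 1 1 = 2) : g = 1 := by
  obtain ⟨v, hv, hgv⟩ := exists_eigenvector g (μ := 1) (by rw [htr]; norm_num)
  obtain ⟨h1, h2⟩ := colMat_conj_apply g hv hgv
  generalize colMat v hv = f at h1 h2
  obtain ⟨u, hu⟩ : ∃ u, u = f⁻¹ * g * f := ⟨_, rfl⟩
  rw [← hu] at h1 h2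
  have h3 : u 1 1 = 1 := by
    have := sl_det u
    rw [h1, h2] at this
    linarith
  obtain ⟨R, hR⟩ := H.bounded
  obtain ⟨ε, hε, hd⟩ := H.discrete
  -- Conjugation by diag(s, s⁻¹) multiplies the off-diagonal entry of u by s⁻². Undoing the
  -- unbounded conjugator by a γ in Λ leaves a matrix k bounded by R, so γgγ⁻¹ is within 4 R² s⁻²
  -- |u₀₁| of 1; s makes this less than ε.
  obtain ⟨s, hs⟩ : ∃ s, s = 4 * R ^ 2 * |u 0 1| / ε + 1 := ⟨_, rfl⟩
  have hs1 : 1 ≤ s := by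
    have : 0 ≤ 4 * R ^ 2 * |u 0 1| / ε := by positivity
    linarith
  have hs0 : s ≠ 0 := by linarith
  obtain ⟨γ, hγ, hb⟩ := hR (f * diagMat s hs0)
  obtain ⟨k, hk⟩ : ∃ k, k = γ * (f * diagMat s hs0) := ⟨_, rfl⟩
  rw [← hk] at hb
  have e1 : γ * g * γ⁻¹ = k * ((diagMat s hs0)⁻¹ * u * diagMat s hs0) * k⁻¹ := by
    rw [hk, hu]; group
  obtain ⟨k1, k2, k3, k4⟩ := diagMat_apply s hs0
  obtain ⟨l1, l2, l3, l4⟩ := sl_inv_apply (diagMat s hs0)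
  obtain ⟨o1, o2, o3, o4⟩ := sl_one_apply
  have e2 : ∀ i j, |((diagMat s hs0)⁻¹ * u * diagMat s hs0) i j - (1 : SL(2, ℝ)) i j| ≤
      s⁻¹ ^ 2 * |u 0 1| := by
    intro i j
    have h0 : 0 ≤ s⁻¹ ^ 2 * |u 0 1| := by positivity
    fin_cases i <;> fin_cases j <;>
      simp only [Fin.zero_eta, Fin.mk_one, sl_mul_apply, k1, k2, k3, k4, l1, l2, l3, l4, h1, h2, h3,
        o1, o2, o3, o4]
    · convert h0
      simp [hs0]
    · apply le_of_eq
      rw [← abs_of_nonneg (a := s⁻¹ ^ 2) (by positivity), ← abs_mul]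
      congr 1
      ring
    · simpa using h0
    · convert h0
      simp [hs0]
  have h4 := hd _ (H.normal γ hγ g hg) fun i j => by
    rw [e1]
    refine (abs_conj_sub_one_le hb e2 i j).trans_lt ?_
    have h5 : 4 * R ^ 2 * |u 0 1| < ε * s ^ 2 := by
      have h6 : 4 * R ^ 2 * |u 0 1| = ε * (s - 1) := by rw [hs]; field_simp; ring
      rw [h6]
      have : s ≤ s ^ 2 := by nlinarith
      exact mul_lt_mul_of_pos_left (by linarith) hε
    calc 4 * R ^ 2 * (s⁻¹ ^ 2 * |u 0 1|) = 4 * R ^ 2 * |u 0 1| / s ^ 2 := by field_simp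
      _ < ε := by rwa [div_lt_iff₀ (by positivity)]
  rwa [conj_eq_one_iff] at h4

/-- Squaring makes the trace positive: tr g² = (tr g)² - 2. The case |tr g| = 2 is excluded by the
absence of parabolics, applied to g or to -g. -/
theorem exists_two_lt_trace (H : CocompactNormalPair Λ N)
    (hN : ∃ g ∈ N, g ≠ 1 ∧ g ≠ -1) : ∃ g ∈ N, 2 < g 0 0 + g 1 1 := by
  obtain ⟨g, hg, h1, h2⟩ := hN
  have ht := H.two_le_abs_trace g hg
  have hne : |g 0 0 + g 1 1| ≠ 2 := by
    intro h
    rcases (abs_eq two_pos.le).1 h with h | h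
    · exact h1 (H.eq_one_of_trace_eq_two hg h)
    · refine h2 ?_
      have := H.eq_one_of_trace_eq_two (N.mul_mem H.neg_one_mem hg) (by
        simp; linarith)
      rw [neg_mul, one_mul] at this
      rw [← this, neg_neg]
  have hlt := lt_of_le_of_ne ht hne.symm
  refine ⟨g * g, N.mul_mem hg hg, ?_⟩
  simp only [sl_mul_apply]
  have hsq : 2 ^ 2 < (g 0 0 + g 1 1) ^ 2 := sq_lt_sq.2 (by rwa [abs_two])
  linarith [sl_det g]

section Diagonal

variable {a : ℝ} (ha : 1 < a)

theorem diagMat_pow_mem (hh : diagMat a (zero_lt_one.trans ha).ne' ∈ N) (m : ℕ) :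
    diagMat (a ^ m) (pow_ne_zero m (zero_lt_one.trans ha).ne') ∈ N := by
  rw [← diagMat_pow]
  exact N.pow_mem hh m

/-- The commutator of g and h has trace 2 - (a - a⁻¹)² g₀₁ g₁₀. If g₀₁ g₁₀ = 0 it is trivial, for
want of parabolics, so g commutes with h and is diagonal. -/
theorem apply_eq_zero_iff (H : CocompactNormalPair Λ N)
    (hh : diagMat a (zero_lt_one.trans ha).ne' ∈ N) {g : SL(2, ℝ)} (hg : g ∈ N) :
    g 0 1 = 0 ↔ g 1 0 = 0 := by
  have ha0 := (zero_lt_one.trans ha).ne'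
  set h := diagMat a ha0 with hhdef
  obtain ⟨k1, k2, k3, k4⟩ := diagMat_apply a ha0
  obtain ⟨l1, l2, l3, l4⟩ := sl_inv_apply h
  obtain ⟨m1, m2, m3, m4⟩ := sl_inv_apply g
  have hne : a⁻¹ ≠ a := ((inv_lt_one_of_one_lt₀ ha).trans ha).ne
  have hcomm : g 0 1 * g 1 0 = 0 → g * h = h * g := by
    intro h0
    have := H.eq_one_of_trace_eq_two (g := g * h * g⁻¹ * h⁻¹)
      (N.mul_mem (N.mul_mem (N.mul_mem hg hh) (N.inv_mem hg)) (N.inv_mem hh)) (by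
        simp only [sl_mul_apply, l1, l2, l3, l4, m1, m2, m3, m4]
        simp only [hhdef, k1, k2, k3, k4]
        have hai : a * a⁻¹ = 1 := mul_inv_cancel₀ ha0
        linear_combination (2 * g 0 0 * g 1 1) * hai + 2 * sl_det g + (2 - a ^ 2 - a⁻¹ ^ 2) * h0)
    rw [mul_inv_eq_one, mul_inv_eq_iff_eq_mul] at this
    exact this
  constructor
  · intro h0
    have := congrArg (fun M : SL(2, ℝ) => M 1 0) (hcomm (by rw [h0, zero_mul]))
    simp only [sl_mul_apply, hhdef, k1, k3, k4] at this
    have h1 : (a⁻¹ - a) * g 1 0 = 0 := by linarith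
    exact (mul_eq_zero.1 h1).resolve_left (sub_ne_zero.2 hne)
  · intro h0
    have := congrArg (fun M : SL(2, ℝ) => M 0 1) (hcomm (by rw [h0, mul_zero]))
    simp only [sl_mul_apply, hhdef, k1, k2, k4] at this
    have h1 : (a⁻¹ - a) * g 0 1 = 0 := by linarith
    exact (mul_eq_zero.1 h1).resolve_left (sub_ne_zero.2 hne)

theorem exists_apply_ne_zero (H : CocompactNormalPair Λ N)
    (hh : diagMat a (zero_lt_one.trans ha).ne' ∈ N) :
    ∃ g ∈ N, g 0 0 ≠ 0 ∧ g 0 1 ≠ 0 ∧ g 1 0 ≠ 0 := by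
  have ha0 := (zero_lt_one.trans ha).ne'
  have hne : a⁻¹ ≠ a := ((inv_lt_one_of_one_lt₀ ha).trans ha).ne
  have hex : ∃ g ∈ N, g 0 1 ≠ 0 := by
    -- Otherwise every γhγ⁻¹ is diagonal, so each γ in Λ preserves or exchanges the axes. The
    -- coordinates of γ(1, 1) then have product ±1, although some γ makes both smaller than 1.
    by_contra! hcon
    obtain ⟨γ, hγ, h1, h2⟩ := H.exists_linAct_small (1, 1) one_pos
    have hc := H.normal γ hγ _ hh
    have e1 := hcon _ hc
    have e2 := (H.apply_eq_zero_iff ha hh hc).1 e1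
    obtain ⟨k1, k2, k3, k4⟩ := diagMat_apply a ha0
    obtain ⟨l1, l2, l3, l4⟩ := sl_inv_apply γ
    simp only [sl_mul_apply, k1, k2, k3, k4, l1, l2, l3, l4] at e1 e2
    have e3 : γ 0 0 * γ 0 1 = 0 := by
      have : (a⁻¹ - a) * (γ 0 0 * γ 0 1) = 0 := by linarith
      exact (mul_eq_zero.1 this).resolve_left (sub_ne_zero.2 hne)
    have e4 : γ 1 0 * γ 1 1 = 0 := by
      have : (a⁻¹ - a) * (γ 1 0 * γ 1 1) = 0 := by linarith
      exact (mul_eq_zero.1 this).resolve_left (sub_ne_zero.2 hne)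
    simp only [linAct, mul_one] at h1 h2
    have hdet := sl_det γ
    have hlt : |(γ 0 0 + γ 0 1) * (γ 1 0 + γ 1 1)| < 1 := by
      rw [abs_mul]
      exact mul_lt_one_of_nonneg_of_lt_one_left (abs_nonneg _) h1 h2.le
    refine hlt.ne ?_
    rcases mul_eq_zero.1 e3 with h | h
    · have h5 : γ 0 1 ≠ 0 := fun h' => by rw [h, h'] at hdet; norm_num at hdet
      have h6 : γ 1 0 ≠ 0 := fun h' => by rw [h, h'] at hdet; norm_num at hdet
      have h7 := (mul_eq_zero.1 e4).resolve_left h6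
      rw [abs_eq one_pos.le]
      right
      rw [h, h7] at hdet ⊢
      linarith
    · have h5 : γ 1 1 ≠ 0 := fun h' => by rw [h, h'] at hdet; norm_num at hdet
      have h7 := (mul_eq_zero.1 e4).resolve_right h5
      rw [abs_eq one_pos.le]
      left
      rw [h, h7] at hdet ⊢
      linarith
  obtain ⟨g, hg, hq⟩ := hex
  have hr : g 1 0 ≠ 0 := fun h => hq ((H.apply_eq_zero_iff ha hh hg).2 h)
  by_cases hp : g 0 0 = 0
  · obtain ⟨l1, l2, l3, l4⟩ := sl_inv_apply g
    refine ⟨g⁻¹, N.inv_mem hg, ?_, by rw [l2]; exact neg_ne_zero.2 hq,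
      by rw [l3]; exact neg_ne_zero.2 hr⟩
    intro h
    have := H.two_le_abs_trace g hg
    rw [l1] at h
    rw [hp, h] at this
    norm_num at this
  · exact ⟨g, hg, hp, hq, hr⟩

end Diagonal

end CocompactNormalPair

/-- A closed homogeneous subset of the plane stable under `diagMat a`, `a > 1`, that contains a
vector with nonzero first coordinate contains the first basis vector. -/
theorem fst_basis_mem {a : ℝ} (ha : 1 < a) {L : Set (ℝ × ℝ)} (hL : IsClosed L)
    (hsmul : ∀ (t : ℝ), ∀ u ∈ L, t • u ∈ L)
    (hdiag : ∀ m : ℕ, ∀ u ∈ L,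
      linAct (diagMat (a ^ m) (pow_ne_zero m (zero_lt_one.trans ha).ne')) u ∈ L)
    {u : ℝ × ℝ} (hu : u ∈ L) (h : u.1 ≠ 0) : ((1 : ℝ), (0 : ℝ)) ∈ L := by
  have ht : Tendsto (fun m : ℕ => ((1 : ℝ), ((a ^ m)⁻¹) ^ 2 * (u.2 / u.1))) atTop
      (𝓝 (1, 0 * (u.2 / u.1))) :=
    tendsto_const_nhds.prodMk_nhds ((tendsto_inv_pow_sq ha).mul_const _)
  rw [zero_mul] at ht
  refine hL.mem_of_tendsto ht (Eventually.of_forall fun m => ?_)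
  have := hsmul ((a ^ m)⁻¹ / u.1) _ (hdiag m u hu)
  convert this using 1
  have : a ^ m ≠ 0 := pow_ne_zero m (zero_lt_one.trans ha).ne'
  rw [linAct_diagMat, Prod.smul_mk, Prod.mk.injEq, smul_eq_mul, smul_eq_mul]
  constructor <;> field_simp

theorem snd_basis_mem {a : ℝ} (ha : 1 < a) {L : Set (ℝ × ℝ)} (hL : IsClosed L)
    (hsmul : ∀ (t : ℝ), ∀ u ∈ L, t • u ∈ L)
    (hdiag : ∀ m : ℕ, ∀ u ∈ L,
      linAct (diagMat (a ^ m) (pow_ne_zero m (zero_lt_one.trans ha).ne'))⁻¹ u ∈ L)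
    {u : ℝ × ℝ} (hu : u ∈ L) (h : u.2 ≠ 0) : ((0 : ℝ), (1 : ℝ)) ∈ L := by
  have ht : Tendsto (fun m : ℕ => (((a ^ m)⁻¹) ^ 2 * (u.1 / u.2), (1 : ℝ))) atTop
      (𝓝 (0 * (u.1 / u.2), 1)) :=
    ((tendsto_inv_pow_sq ha).mul_const _).prodMk_nhds tendsto_const_nhds
  rw [zero_mul] at ht
  refine hL.mem_of_tendsto ht (Eventually.of_forall fun m => ?_)
  have := hsmul ((a ^ m)⁻¹ / u.2) _ (hdiag m u hu)
  convert this using 1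
  have : a ^ m ≠ 0 := pow_ne_zero m (zero_lt_one.trans ha).ne'
  rw [diagMat_inv, linAct_diagMat, Prod.smul_mk, Prod.mk.injEq, smul_eq_mul, smul_eq_mul]
  constructor <;> field_simp

/-! ### Closed subsets of the plane stable under the normal subgroup or the cocompact group -/

namespace CocompactNormalPair

variable {Λ N : Subgroup SL(2, ℝ)} {a : ℝ}

/-- Conjugating g by h^m keeps the first coordinate of g(t, 0) and contracts the second by a^(-2m).
-/
theorem fst_axis_mul_apply_mem (ha : 1 < a) (hh : diagMat a (zero_lt_one.trans ha).ne' ∈ N)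
    {D : Set (ℝ × ℝ)} (hD : IsClosed D) (hDN : ∀ g ∈ N, ∀ u ∈ D, linAct g u ∈ D)
    {t : ℝ} (ht : (t, (0 : ℝ)) ∈ D) {g : SL(2, ℝ)} (hg : g ∈ N) : (g 0 0 * t, (0 : ℝ)) ∈ D := by
  have hlim : Tendsto (fun m : ℕ => (g 0 0 * t, ((a ^ m)⁻¹) ^ 2 * (g 1 0 * t))) atTop
      (𝓝 (g 0 0 * t, 0 * (g 1 0 * t))) :=
    tendsto_const_nhds.prodMk_nhds ((tendsto_inv_pow_sq ha).mul_const _)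
  rw [zero_mul] at hlim
  refine hD.mem_of_tendsto hlim (Eventually.of_forall fun m => ?_)
  have hm := diagMat_pow_mem ha hh m
  have := hDN _ hm _ (hDN _ hg _ (hDN _ (N.inv_mem hm) _ ht))
  convert this using 1
  have : a ^ m ≠ 0 := pow_ne_zero m (zero_lt_one.trans ha).ne'
  rw [diagMat_inv, linAct_diagMat, linAct_diagMat]
  simp only [linAct, Prod.mk.injEq]
  constructor <;> field_simp <;> ring

/-- A closed set stable under the normal subgroup that contains one nonzero multiple of an
eigenvector contains all of them. -/
theorem fst_axis_mem (H : CocompactNormalPair Λ N) (ha : 1 < a)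
    (hh : diagMat a (zero_lt_one.trans ha).ne' ∈ N)
    {D : Set (ℝ × ℝ)} (hD : IsClosed D) (hDN : ∀ g ∈ N, ∀ u ∈ D, linAct g u ∈ D)
    {x : ℝ} (hx : x ≠ 0) (hxD : (x, (0 : ℝ)) ∈ D) (t : ℝ) : (t, (0 : ℝ)) ∈ D := by
  have ha0 := zero_lt_one.trans ha
  obtain ⟨g, hg, hp, hq, hr⟩ := H.exists_apply_ne_zero ha hh
  have hstep : ∀ {t : ℝ}, (t, (0 : ℝ)) ∈ D → ∀ g ∈ N, (g 0 0 * t, (0 : ℝ)) ∈ D :=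
    fun ht g hg => fst_axis_mul_apply_mem ha hh hD hDN ht hg
  obtain ⟨S, hSdef⟩ : ∃ S : Set ℝ, S = {s | (Real.exp s * x, (0 : ℝ)) ∈ D} := ⟨_, rfl⟩
  have hmem : ∀ s, s ∈ S ↔ (Real.exp s * x, (0 : ℝ)) ∈ D := fun s => by rw [hSdef]; rfl
  have hScl : IsClosed S := by
    rw [hSdef]
    exact hD.preimage (by fun_prop)
  have hadd : ∀ g ∈ N, 0 < g 0 0 → ∀ s ∈ S, s + Real.log (g 0 0) ∈ S := by
    intro g hg hpos s hs
    rw [hmem] at hs ⊢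
    have := hstep hs g hg
    rwa [Real.exp_add, Real.exp_log hpos, mul_comm (Real.exp s), mul_assoc]
  obtain ⟨k1, k2, k3, k4⟩ := diagMat_apply a ha0.ne'
  -- The square is positive whatever the sign of g₀₀, so its logarithm can serve as the translation
  -- c.
  have hp2 : 0 < g 0 0 * g 0 0 := mul_self_pos.2 hp
  have hS : S = univ := by
    refine eq_univ_of_add_mem hScl ?_ (Real.log_pos ha) (c := Real.log (g 0 0 * g 0 0)) ?_ ?_ ?_ ?_
    · rw [hmem]; simpa using hxD
    · have := hadd _ hh (by rw [k1]; exact ha0)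
      rwa [k1] at this
    · have := hadd _ (N.inv_mem hh)
      rw [(sl_inv_apply _).1, k4, Real.log_inv] at this
      simpa [sub_eq_add_neg] using this (inv_pos.2 ha0)
    · intro s hs
      rw [hmem] at hs ⊢
      have := hstep (hstep hs g hg) g hg
      rw [Real.exp_add, Real.exp_log hp2]
      convert this using 2
      ring
    · intro ε hε
      -- The element g h^m g h^(-m) of `N` has upper left entry g₀₀² + a^(-2m) g₀₁ g₁₀, which tends
      -- to g₀₀² without ever equalling it.
      have h1 : Tendsto (fun m : ℕ => 1 + ((a ^ m)⁻¹) ^ 2 * (g 0 1 * g 1 0 / (g 0 0 * g 0 0)))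
          atTop (𝓝 1) := by
        simpa using ((tendsto_inv_pow_sq ha).mul_const
          (g 0 1 * g 1 0 / (g 0 0 * g 0 0))).const_add 1
      have h2 := (Real.continuousAt_log one_ne_zero).tendsto.comp h1
      rw [Real.log_one] at h2
      obtain ⟨m, hm1, hm2⟩ := ((h1.eventually (lt_mem_nhds one_pos)).and
        (h2.eventually (Metric.ball_mem_nhds 0 hε))).exists
      have hm0 : a ^ m ≠ 0 := pow_ne_zero m ha0.ne'
      refine ⟨Real.log (1 + ((a ^ m)⁻¹) ^ 2 * (g 0 1 * g 1 0 / (g 0 0 * g 0 0))), ?_, ?_, ?_⟩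
      · intro h0
        rw [Real.log_eq_zero] at h0
        have : ((a ^ m)⁻¹) ^ 2 * (g 0 1 * g 1 0 / (g 0 0 * g 0 0)) ≠ 0 := by positivity
        rcases h0 with h0 | h0 | h0
        · exact hm1.ne' h0
        · exact this (by linarith)
        · linarith
      · simpa using hm2
      · intro s hs
        rw [← Real.log_mul hp2.ne' hm1.ne']
        have hmN := diagMat_pow_mem ha hh m
        obtain ⟨l1, l2, l3, l4⟩ := diagMat_apply (a ^ m) hm0
        obtain ⟨n1, n2, n3, n4⟩ := sl_inv_apply (diagMat (a ^ m) hm0)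
        have e : (g * diagMat (a ^ m) hm0 * g * (diagMat (a ^ m) hm0)⁻¹) 0 0 =
            g 0 0 * g 0 0 * (1 + ((a ^ m)⁻¹) ^ 2 * (g 0 1 * g 1 0 / (g 0 0 * g 0 0))) := by
          simp only [sl_mul_apply, l1, l2, l3, l4, n1, n3]
          field_simp
          ring
        rw [← e]
        refine hadd _ (N.mul_mem (N.mul_mem (N.mul_mem hg hmN) hg) (N.inv_mem hmN)) ?_ s hs
        rw [e]
        exact mul_pos hp2 hm1
  have hexp : ∀ s : ℝ, (Real.exp s * x, (0 : ℝ)) ∈ D := fun s => by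
    rw [← hmem, hS]; trivial
  have hpos : ∀ t : ℝ, 0 < t / x → (t, (0 : ℝ)) ∈ D := fun t ht => by
    have := hexp (Real.log (t / x))
    rwa [Real.exp_log ht, div_mul_cancel₀ _ hx] at this
  rcases lt_trichotomy (t / x) 0 with h | h | h
  · have := hstep (hpos (-t) (by rw [neg_div]; linarith)) _ H.neg_one_mem
    simpa using this
  · have ht : t = 0 := by simpa [hx] using h
    have hlim : Tendsto (fun s : ℝ => (Real.exp s * x, (0 : ℝ))) atBot (𝓝 (0 * x, 0)) :=
      (Real.tendsto_exp_atBot.mul_const x).prodMk_nhds tendsto_const_nhds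
    rw [zero_mul] at hlim
    rw [ht]
    exact hD.mem_of_tendsto hlim (Eventually.of_forall hexp)
  · exact hpos t h

/-- A closed homogeneous set stable under the normal subgroup that contains an eigenvector
is the whole plane. -/
theorem eq_univ_of_smul_mem (H : CocompactNormalPair Λ N) (ha : 1 < a)
    (hh : diagMat a (zero_lt_one.trans ha).ne' ∈ N)
    {L : Set (ℝ × ℝ)} (hL : IsClosed L) (hLN : ∀ g ∈ N, ∀ u ∈ L, linAct g u ∈ L)
    (hsmul : ∀ (t : ℝ), ∀ u ∈ L, t • u ∈ L) (hmem : ((1 : ℝ), (0 : ℝ)) ∈ L) : L = univ := by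
  obtain ⟨g, hg, hp, hq, hr⟩ := H.exists_apply_ne_zero ha hh
  -- By normality γ⁻¹L is again `N`-stable. It contains γ⁻¹e₁ and γ⁻¹ge₁, at least one of which has
  -- the coordinate that powers of h or h⁻¹ amplify into a basis direction.
  have hbasis : ∀ γ ∈ Λ, linAct γ (1, 0) ∈ L ∧ linAct γ (0, 1) ∈ L := by
    intro γ hγ
    have hcl : IsClosed (linAct γ ⁻¹' L) := hL.preimage (continuous_linAct γ)
    have hsm : ∀ (t : ℝ), ∀ u ∈ linAct γ ⁻¹' L, t • u ∈ linAct γ ⁻¹' L := fun t u hu => by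
      rw [mem_preimage, linAct_smul]
      exact hsmul t _ hu
    have hN : ∀ k ∈ N, ∀ u ∈ linAct γ ⁻¹' L, linAct k u ∈ linAct γ ⁻¹' L := fun k hk u hu => by
      have := hLN _ (H.normal γ hγ k hk) _ hu
      rwa [← linAct_mul, inv_mul_cancel_right, linAct_mul] at this
    have h1 : linAct γ⁻¹ (1, 0) ∈ linAct γ ⁻¹' L := by
      rwa [mem_preimage, linAct_linAct_inv]
    have h2 : linAct γ⁻¹ (linAct g (1, 0)) ∈ linAct γ ⁻¹' L := by
      rw [mem_preimage, linAct_linAct_inv]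
      exact hLN g hg _ hmem
    obtain ⟨k1, k2, k3, k4⟩ := sl_inv_apply γ
    have hdet := sl_det γ
    simp only [linAct, k1, k2, k3, k4] at h1 h2
    constructor
    · by_cases h : γ 1 1 = 0
      · refine fst_basis_mem ha hcl hsm (fun m => hN _ (diagMat_pow_mem ha hh m)) h2 ?_
        have : γ 0 1 ≠ 0 := fun h' => by rw [h, h'] at hdet; norm_num at hdet
        simp [h, this, hr]
      · refine fst_basis_mem ha hcl hsm (fun m => hN _ (diagMat_pow_mem ha hh m)) h1 ?_
        simpa using h
    · by_cases h : γ 1 0 = 0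
      · refine snd_basis_mem ha hcl hsm (fun m => hN _ (N.inv_mem (diagMat_pow_mem ha hh m))) h2 ?_
        have : γ 0 0 ≠ 0 := fun h' => by rw [h, h'] at hdet; norm_num at hdet
        simp [h, this, hr]
      · refine snd_basis_mem ha hcl hsm (fun m => hN _ (N.inv_mem (diagMat_pow_mem ha hh m))) h1 ?_
        simpa using h
  have hLzero : (0 : ℝ × ℝ) ∈ L := by simpa using hsmul 0 _ hmem
  refine eq_univ_of_forall fun v => ?_
  rcases eq_or_ne v 0 with rfl | hv
  · exact hLzero
  rw [← linAct_colMat v hv]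
  obtain ⟨f, hf⟩ : ∃ f, f = colMat v hv := ⟨_, rfl⟩
  rw [← hf]
  obtain ⟨R, hR⟩ := H.bounded
  -- Some γ in Λ makes k = γ f h^m bounded by R. Then γ⁻¹ = f h^m k⁻¹ sends e₁ and e₂ to f(a^m k₁₁,
  -- -a^(-m) k₁₀) and f(-a^m k₀₁, a^(-m) k₀₀). As det k = 1, one of k₁₁, k₀₁ is at least 1/(2R) in
  -- size, so one of these images is nearly parallel to fe₁.
  have key : ∀ m : ℕ, ∃ y : ℝ, |y| ≤ ((a ^ m)⁻¹) ^ 2 * (2 * R ^ 2) ∧ linAct f (1, y) ∈ L := by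
    intro m
    have hm0 : a ^ m ≠ 0 := pow_ne_zero m (zero_lt_one.trans ha).ne'
    obtain ⟨γ, hγ, hb⟩ := hR (f * diagMat (a ^ m) hm0)
    obtain ⟨k, hk⟩ : ∃ k, k = γ * (f * diagMat (a ^ m) hm0) := ⟨_, rfl⟩
    rw [← hk] at hb
    have hγ' : γ⁻¹ = f * (diagMat (a ^ m) hm0 * k⁻¹) := by rw [hk]; group
    obtain ⟨b1, b2⟩ := hbasis _ (Λ.inv_mem hγ)
    rw [hγ', linAct_mul f] at b1 b2
    have hcl : ∀ x y : ℝ, linAct f (x, y) ∈ L → x ≠ 0 → linAct f (1, y / x) ∈ L := by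
      intro x y h hx
      have := hsmul x⁻¹ _ h
      rw [← linAct_smul] at this
      convert this using 2
      simp [hx, div_eq_inv_mul]
    obtain ⟨n1, n2, n3, n4⟩ := sl_inv_apply k
    have hR0 : 0 ≤ R := (abs_nonneg _).trans (hb 0 0)
    have hbound : ∀ x y : ℝ, 1 ≤ 2 * R * |x| → |y| ≤ R →
        |((a ^ m)⁻¹ * y) / (a ^ m * x)| ≤ ((a ^ m)⁻¹) ^ 2 * (2 * R ^ 2) := by
      intro x y hx hy
      have hx0 : 0 < |x| := by
        by_contra! h
        have : |x| = 0 := le_antisymm h (abs_nonneg _)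
        rw [this] at hx
        linarith
      have e : ((a ^ m)⁻¹ * y) / (a ^ m * x) = ((a ^ m)⁻¹) ^ 2 * (y / x) := by
        field_simp
      rw [e, abs_mul, abs_of_nonneg (by positivity : 0 ≤ ((a ^ m)⁻¹) ^ 2), abs_div]
      refine mul_le_mul_of_nonneg_left ?_ (by positivity)
      rw [div_le_iff₀ hx0]
      calc |y| ≤ R * 1 := by linarith
        _ ≤ R * (2 * R * |x|) := mul_le_mul_of_nonneg_left hx hR0
        _ = _ := by ring
    have hdet := sl_det k
    rw [linAct_mul, linAct_diagMat] at b1 b2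
    simp only [linAct, n1, n2, n3, n4] at b1 b2
    by_cases hx : 1 ≤ 2 * R * |k 1 1|
    · have hne : k 1 1 ≠ 0 := fun h => by rw [h, abs_zero] at hx; linarith
      refine ⟨_, hbound (k 1 1) (-k 1 0) hx (by rw [abs_neg]; exact hb 1 0), ?_⟩
      apply hcl _ _ _ (mul_ne_zero hm0 hne)
      simpa [linAct] using b1
    · have hx' : 1 ≤ 2 * R * |-k 0 1| := by
        rw [abs_neg]
        have h1 : k 0 0 * k 1 1 ≤ R * |k 1 1| := (le_abs_self _).trans (by
          rw [abs_mul]; exact mul_le_mul_of_nonneg_right (hb 0 0) (abs_nonneg _))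
        have h2 : -(k 0 1 * k 1 0) ≤ R * |k 0 1| := (neg_le_abs _).trans (by
          rw [abs_mul, mul_comm]; exact mul_le_mul_of_nonneg_right (hb 1 0) (abs_nonneg _))
        linarith
      have hne : -k 0 1 ≠ 0 := fun h => by rw [h, abs_zero] at hx'; linarith
      refine ⟨_, hbound (-k 0 1) (k 0 0) hx' (hb 0 0), ?_⟩
      apply hcl _ _ _ (mul_ne_zero hm0 hne)
      simpa [linAct] using b2
  choose y hy hyL using key
  have hy0 : Tendsto y atTop (𝓝 0) := by
    refine squeeze_zero_norm hy ?_
    simpa using (tendsto_inv_pow_sq ha).mul_const (2 * R ^ 2)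
  exact hL.mem_of_tendsto (((continuous_linAct f).tendsto _).comp
    (tendsto_const_nhds.prodMk_nhds hy0)) (Eventually.of_forall hyL)

/-- The vectors whose whole line lies in D form a closed homogeneous `N`-stable set, which contains
the first basis vector by `fst_axis_mem`. -/
theorem eq_univ_of_fst_axis_mem (H : CocompactNormalPair Λ N) (ha : 1 < a)
    (hh : diagMat a (zero_lt_one.trans ha).ne' ∈ N)
    {D : Set (ℝ × ℝ)} (hD : IsClosed D) (hDN : ∀ g ∈ N, ∀ u ∈ D, linAct g u ∈ D)
    {x : ℝ} (hx : x ≠ 0) (hxD : (x, (0 : ℝ)) ∈ D) : D = univ := by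
  have hL : {u | ∀ t : ℝ, t • u ∈ D} = univ := by
    refine H.eq_univ_of_smul_mem ha hh ?_ ?_ ?_ ?_
    · simp only [ofPred_forall]
      exact isClosed_iInter fun t => hD.preimage (continuous_const_smul t)
    · intro g hg u hu t
      rw [← linAct_smul]
      exact hDN g hg _ (hu t)
    · intro t u hu s
      rw [smul_smul]
      exact hu _
    · intro t
      have := H.fst_axis_mem ha hh hD hDN hx hxD t
      simpa using this
  refine eq_univ_of_forall fun u => ?_
  have : u ∈ {u | ∀ t : ℝ, t • u ∈ D} := hL ▸ mem_univ u
  simpa using this 1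

/-- A closed set stable under a cocompact group that contains a nonzero vector contains an
eigenvector. -/
theorem exists_fst_axis_mem (H : CocompactNormalPair Λ N) (ha : 1 < a)
    (hh : diagMat a (zero_lt_one.trans ha).ne' ∈ N)
    {P : Set (ℝ × ℝ)} (hP : IsClosed P) (hPΛ : ∀ γ ∈ Λ, ∀ u ∈ P, linAct γ u ∈ P)
    {v : ℝ × ℝ} (hv : v ≠ 0) (hvP : v ∈ P) : ∃ x : ℝ, x ≠ 0 ∧ (x, (0 : ℝ)) ∈ P := by
  have ha0 := zero_lt_one.trans ha
  obtain ⟨g, hg, hp, hq, hr⟩ := H.exists_apply_ne_zero ha hh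
  obtain ⟨A, hA0, hA⟩ := exists_abs_apply_le g
  have hsmall : ∀ ε > 0, ∃ u ∈ P, u.1 ≠ 0 ∧ |u.1| < ε ∧ |u.2| < ε := by
    intro ε hε
    obtain ⟨γ, hγ, h1, h2⟩ := H.exists_linAct_small v
      (show 0 < min ε (ε / (2 * A)) by positivity)
    rw [lt_min_iff] at h1 h2
    set u := linAct γ v with hu
    -- A vector on the contracted axis is first moved off it by g; the factor 1/(2A) in the bound
    -- keeps its image small.
    by_cases h : u.1 = 0
    · have hu2 : u.2 ≠ 0 := fun h' => linAct_ne_zero γ hv (Prod.ext h h')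
      have hb : ∀ i, |g i 1 * u.2| < ε := fun i => by
        rw [abs_mul]
        calc |g i 1| * |u.2| ≤ A * |u.2| := mul_le_mul_of_nonneg_right (hA i 1) (abs_nonneg _)
          _ < A * (ε / (2 * A)) := mul_lt_mul_of_pos_left h2.2 hA0
          _ = ε / 2 := by field_simp
          _ < ε := by linarith
      refine ⟨linAct g u, hPΛ _ (H.le hg) _ (hPΛ γ hγ _ hvP), ?_, ?_, ?_⟩
      · simp [linAct, h, hq, hu2]
      · simpa [linAct, h] using hb 0
      · simpa [linAct, h] using hb 1
    · exact ⟨u, hPΛ γ hγ _ hvP, h, h1.1, h2.1⟩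
  obtain ⟨Q, hQ⟩ : ∃ Q : Set (ℝ × ℝ), Q = P ∩ {u | 1 ≤ |u.1| ∧ |u.1| ≤ a ∧ |u.2| ≤ 1} := ⟨_, rfl⟩
  have hsmallQ : ∀ ε > 0, ε ≤ 1 → ∃ u ∈ Q, |u.2| < ε := by
    intro ε hε hε1
    obtain ⟨u, huP, hu0, hu1, hu2⟩ := hsmall ε hε
    have hup := abs_pos.2 hu0
    -- Since a^m ≤ 1/|u₁| < a^(m+1), the exponent m + 1 brings the first coordinate into [1, a],
    -- while the second only shrinks.
    obtain ⟨m, hm1, hm2⟩ := exists_nat_pow_near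
      (one_le_inv_iff₀.2 ⟨hup, (hu1.trans_le hε1).le⟩) ha
    have hm := diagMat_pow_mem ha hh (m + 1)
    have ham : 0 < a ^ (m + 1) := pow_pos ha0 _
    have hle : |(a ^ (m + 1))⁻¹ * u.2| ≤ |u.2| := by
      rw [abs_mul, abs_of_pos (inv_pos.2 ham)]
      exact mul_le_of_le_one_left (abs_nonneg _) (inv_le_one_of_one_le₀ (one_le_pow₀ ha.le))
    have hprod : |a ^ (m + 1) * u.1| = a ^ (m + 1) * |u.1| := by rw [abs_mul, abs_of_pos ham]
    refine ⟨linAct (diagMat (a ^ (m + 1)) ham.ne') u, ?_, ?_⟩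
    · rw [hQ]
      refine ⟨hPΛ _ (H.le hm) _ huP, ?_⟩
      rw [linAct_diagMat]
      simp only [mem_ofPred_eq]
      refine ⟨?_, ?_, by linarith⟩
      · rw [hprod]
        rw [inv_lt_iff_one_lt_mul₀ hup] at hm2
        linarith
      · rw [hprod, pow_succ]
        have := mul_le_mul_of_nonneg_right hm1 hup.le
        rw [inv_mul_cancel₀ hup.ne'] at this
        nlinarith
    · rw [linAct_diagMat]
      exact hle.trans_lt hu2
  have hQc : IsCompact Q := by
    have hc : IsClosed Q := by
      rw [hQ]
      refine hP.inter ?_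
      exact (isClosed_le continuous_const continuous_fst.abs).inter
        ((isClosed_le continuous_fst.abs continuous_const).inter
          (isClosed_le continuous_snd.abs continuous_const))
    refine ((isCompact_Icc (a := -a) (b := a)).prod
      (isCompact_Icc (a := (-1 : ℝ)) (b := 1))).of_isClosed_subset hc fun u hu => ?_
    rw [hQ] at hu
    exact ⟨abs_le.1 hu.2.2.1, abs_le.1 hu.2.2.2⟩
  have hQn : Q.Nonempty := by
    obtain ⟨u, hu, -⟩ := hsmallQ 1 one_pos le_rfl
    exact ⟨u, hu⟩
  -- Q contains points with arbitrarily small second coordinate, so the minimum over this compact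
  -- set is zero.
  obtain ⟨u, huQ, hmin⟩ := hQc.exists_isMinOn hQn (f := fun u => |u.2|) (by fun_prop)
  have hu2 : u.2 = 0 := by
    by_contra h
    obtain ⟨w, hw, hlt⟩ := hsmallQ (min |u.2| 1) (lt_min (abs_pos.2 h) one_pos) (min_le_right _ _)
    have := hmin hw
    simp only [mem_ofPred_eq] at this
    exact absurd (hlt.trans_le (min_le_left _ _)) (not_lt.2 this)
  rw [hQ] at huQ
  refine ⟨u.1, fun h => ?_, ?_⟩
  · have := huQ.2.1
    rw [h, abs_zero] at this
    linarith
  · rw [← hu2]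
    exact huQ.1

/-- There is a set of nonzero vectors that meets the closure of every orbit of the cocompact group
and consists of vectors whose orbits under the normal subgroup are dense. -/
theorem exists_eigenvectors (H : CocompactNormalPair Λ N) (hN : ∃ g ∈ N, g ≠ 1 ∧ g ≠ -1) :
    ∃ W : Set (ℝ × ℝ), (0 : ℝ × ℝ) ∉ W ∧
      (∀ P : Set (ℝ × ℝ), IsClosed P → (∀ γ ∈ Λ, ∀ u ∈ P, linAct γ u ∈ P) →
        ∀ v ∈ P, v ≠ 0 → ∃ w ∈ W, w ∈ P) ∧
      (∀ D : Set (ℝ × ℝ), IsClosed D → (∀ g ∈ N, ∀ u ∈ D, linAct g u ∈ D) →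
        ∀ w ∈ W, w ∈ D → D = univ) := by
  obtain ⟨h, hhN, htr⟩ := H.exists_two_lt_trace hN
  obtain ⟨Q, a, ha, hQ⟩ := exists_conj_eq_diagMat h htr
  have H' := H.conj Q
  have hh : diagMat a (zero_lt_one.trans ha).ne' ∈ N.comap (MulAut.conj Q).toMonoidHom := by
    rw [← hQ, Subgroup.mem_comap]
    simpa [mul_assoc] using hhN
  have hinv : ∀ (K : Subgroup SL(2, ℝ)) (P : Set (ℝ × ℝ)), (∀ γ ∈ K, ∀ u ∈ P, linAct γ u ∈ P) →
      ∀ γ ∈ K.comap (MulAut.conj Q).toMonoidHom, ∀ u ∈ linAct Q ⁻¹' P,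
        linAct γ u ∈ linAct Q ⁻¹' P := by
    intro K P hP γ hγ u hu
    have := hP _ hγ _ hu
    simpa [← linAct_mul] using this
  -- W consists of the nonzero eigenvectors of h for its eigenvalue a > 1.
  refine ⟨{w | ∃ x : ℝ, x ≠ 0 ∧ w = linAct Q (x, 0)}, ?_, ?_, ?_⟩
  · rintro ⟨x, hx, h0⟩
    exact linAct_ne_zero Q (v := (x, 0)) (by simpa using hx) h0.symm
  · intro P hP hPΛ v hvP hv
    obtain ⟨x, hx, hxP⟩ := H'.exists_fst_axis_mem ha hh (hP.preimage (continuous_linAct Q))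
      (hinv Λ P hPΛ) (v := linAct Q⁻¹ v) (linAct_ne_zero _ hv)
      (by rwa [mem_preimage, linAct_linAct_inv])
    exact ⟨_, ⟨x, hx, rfl⟩, hxP⟩
  · rintro D hD hDN w ⟨x, hx, rfl⟩ hw
    have := H'.eq_univ_of_fst_axis_mem ha hh (hD.preimage (continuous_linAct Q))
      (hinv N D hDN) hx hw
    refine eq_univ_of_forall fun u => ?_
    have hu : linAct Q⁻¹ u ∈ linAct Q ⁻¹' D := this ▸ mem_univ _
    rwa [mem_preimage, linAct_linAct_inv] at hu

end CocompactNormalPair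

/-! ### From `SL(2, ℝ)` to `PSL(2, ℝ)` and the upper half-plane -/

theorem mk_smul (g : SL(2, ℝ)) (z : ℍ) : (QuotientGroup.mk g : PSL(2, ℝ)) • z = g • z := rfl

theorem mk_neg_one : (QuotientGroup.mk (-1 : SL(2, ℝ)) : PSL(2, ℝ)) = 1 := by
  rw [QuotientGroup.eq_one_iff, Subgroup.mem_center_iff]
  intro g
  simp

theorem eq_one_or_eq_neg_one {g : SL(2, ℝ)} (hg : (QuotientGroup.mk g : PSL(2, ℝ)) = 1) :
    g = 1 ∨ g = -1 := by
  rw [QuotientGroup.eq_one_iff, Matrix.SpecialLinearGroup.mem_center_iff] at hg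
  obtain ⟨r, hr, h⟩ := hg
  rw [Fintype.card_fin, ← one_pow 2, sq_eq_sq_iff_eq_or_eq_neg] at hr
  have h' : ∀ i j, g i j = Matrix.scalar (Fin 2) r i j := fun i j => by rw [h]
  rcases hr with rfl | rfl
  · left
    apply sl_ext <;> simp [h']
  · right
    apply sl_ext <;> simp [h']

theorem eq_or_eq_neg_of_mk_eq {g h : SL(2, ℝ)}
    (hgh : (QuotientGroup.mk g : PSL(2, ℝ)) = QuotientGroup.mk h) : h = g ∨ h = -g := by
  have h1 : (QuotientGroup.mk (g⁻¹ * h) : PSL(2, ℝ)) = 1 := by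
    rw [QuotientGroup.mk_mul, QuotientGroup.mk_inv, hgh, inv_mul_cancel]
  rcases eq_one_or_eq_neg_one h1 with h2 | h2
  · exact .inl (inv_mul_eq_one.1 h2).symm
  · right
    rw [inv_mul_eq_iff_eq_mul] at h2
    simpa using h2

instance : ContinuousConstSMul PSL(2, ℝ) ℍ where
  continuous_const_smul p := by
    induction p using QuotientGroup.induction_on with
    | H g => exact continuous_const_smul g

/-- These are the imaginary and real parts of (k • i)(k₁₀ i + k₁₁) = k₀₀ i + k₀₁, in the order real,
imaginary. -/
theorem coe_smul_I_mul (k : SL(2, ℝ)) :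
    (k • UpperHalfPlane.I).re * k 1 1 - (k • UpperHalfPlane.I).im * k 1 0 = k 0 1 ∧
    (k • UpperHalfPlane.I).re * k 1 0 + (k • UpperHalfPlane.I).im * k 1 1 = k 0 0 := by
  have h := coe_psl_smul k UpperHalfPlane.I
  rw [mk_smul] at h
  have hne : ((k 1 0 : ℝ) : ℂ) * (UpperHalfPlane.I : ℍ) + ((k 1 1 : ℝ) : ℂ) ≠ 0 := by
    intro h0
    have h1 := congrArg Complex.re h0
    have h2 := congrArg Complex.im h0
    simp at h1 h2
    have := sl_det k
    rw [h1, h2] at this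
    norm_num at this
  rw [eq_div_iff hne] at h
  have h1 := congrArg Complex.re h
  have h2 := congrArg Complex.im h
  simp at h1 h2
  exact ⟨h1, h2⟩

/-- The orbit map at i is proper: Im(k • i) = 1/(k₁₀² + k₁₁²) bounds the bottom row, and
`coe_smul_I_mul` then bounds the top row. -/
theorem abs_apply_le_of_smul_I {k : SL(2, ℝ)} {c : ℝ} (hc : 1 ≤ c)
    (h1 : ‖((k • UpperHalfPlane.I : ℍ) : ℂ)‖ < c) (h2 : 1 / c < (k • UpperHalfPlane.I).im)
    (i j : Fin 2) : |k i j| ≤ 2 * c ^ 2 := by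
  obtain ⟨e1, e2⟩ := coe_smul_I_mul k
  have hx : |(k • UpperHalfPlane.I).re| < c := (Complex.abs_re_le_norm _).trans_lt h1
  have hy : |(k • UpperHalfPlane.I).im| < c := (Complex.abs_im_le_norm _).trans_lt h1
  set x := (k • UpperHalfPlane.I).re
  set y := (k • UpperHalfPlane.I).im
  have hdet := sl_det k
  have hc0 : 0 < c := by linarith
  have e3 : y * (k 1 0 ^ 2 + k 1 1 ^ 2) = 1 := by
    rw [← e1, ← e2] at hdet
    linear_combination hdet
  have e4 : k 1 0 ^ 2 + k 1 1 ^ 2 ≤ c ^ 2 := by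
    have h3 : 1 < y * c := by rwa [div_lt_iff₀ hc0] at h2
    have hy0 : 0 < y := (by positivity : 0 < 1 / c).trans h2
    have h4 : y * (k 1 0 ^ 2 + k 1 1 ^ 2) ≤ y * c := by linarith
    have h5 := le_of_mul_le_mul_left h4 hy0
    nlinarith
  have hk0 : |k 1 0| ≤ c := abs_le_of_sq_le_sq (by linarith [sq_nonneg (k 1 1)]) hc0.le
  have hk1 : |k 1 1| ≤ c := abs_le_of_sq_le_sq (by linarith [sq_nonneg (k 1 0)]) hc0.le
  have hcc : c ≤ 2 * c ^ 2 := by nlinarith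
  have hm : ∀ {u v : ℝ}, |u| < c → |v| ≤ c → |u * v| ≤ c ^ 2 := fun hu hv => by
    rw [abs_mul, sq]
    exact mul_le_mul hu.le hv (abs_nonneg _) hc0.le
  fin_cases i <;> fin_cases j <;> simp only [Fin.zero_eta, Fin.mk_one]
  · rw [← e2]
    exact (abs_add_le _ _).trans (by linarith [hm hx hk0, hm hy hk1])
  · rw [← e1]
    exact (abs_sub _ _).trans (by linarith [hm hx hk1, hm hy hk0])
  · exact hk0.trans hcc
  · exact hk1.trans hcc

/-- Elliptic matrices have a fixed point in the upper half-plane. -/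
theorem exists_smul_eq_of_abs_trace_lt (g : SL(2, ℝ)) (hg : |g 0 0 + g 1 1| < 2) :
    ∃ z : ℍ, g • z = z := by
  have hdet := sl_det g
  have htr : (g 0 0 + g 1 1) ^ 2 < 4 := by
    have := sq_lt_sq.2 (hg.trans_eq abs_two.symm)
    linarith
  have hc : g 1 0 ≠ 0 := by
    intro h
    rw [h] at hdet
    nlinarith [sq_nonneg (g 0 0 - g 1 1)]
  have hs : √(4 - (g 0 0 + g 1 1) ^ 2) ^ 2 = 4 - (g 0 0 + g 1 1) ^ 2 := Real.sq_sqrt (by linarith)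
  have hs0 : 0 < √(4 - (g 0 0 + g 1 1) ^ 2) := Real.sqrt_pos.2 (by linarith)
  set s := √(4 - (g 0 0 + g 1 1) ^ 2)
  -- The fixed point x + iy is the root in ℍ of g₁₀ z² + (g₁₁ - g₀₀) z - g₀₁ = 0.
  obtain ⟨x, hx⟩ : ∃ x : ℝ, x = (g 0 0 - g 1 1) / (2 * g 1 0) := ⟨_, rfl⟩
  obtain ⟨y, hy⟩ : ∃ y : ℝ, y = s / (2 * |g 1 0|) := ⟨_, rfl⟩
  have hy0 : 0 < y := by rw [hy]; positivity
  have ex : 2 * g 1 0 * x = g 0 0 - g 1 1 := by rw [hx]; field_simp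
  have ey : 4 * g 1 0 ^ 2 * y ^ 2 = 4 - (g 0 0 + g 1 1) ^ 2 := by
    rw [← hs, hy, ← sq_abs (g 1 0)]
    have := abs_pos.2 hc
    field_simp
    ring
  refine ⟨⟨⟨x, y⟩, hy0⟩, ?_⟩
  apply UpperHalfPlane.ext
  rw [← mk_smul, coe_psl_smul]
  have hne : ((g 1 0 : ℝ) : ℂ) * (⟨x, y⟩ : ℂ) + ((g 1 1 : ℝ) : ℂ) ≠ 0 := by
    intro h0
    have := congrArg Complex.im h0
    simp [hc, hy0.ne'] at this
  have key : ((g 0 0 : ℝ) : ℂ) * (⟨x, y⟩ : ℂ) + ((g 0 1 : ℝ) : ℂ) =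
      ⟨x, y⟩ * (((g 1 0 : ℝ) : ℂ) * (⟨x, y⟩ : ℂ) + ((g 1 1 : ℝ) : ℂ)) := by
    apply Complex.ext
    · simp
      apply mul_left_cancel₀ hc
      linear_combination (-(2 * g 1 0 * x - (g 0 0 - g 1 1)) / 4) * ex + ey / 4 - hdet
    · simp
      linear_combination -y * ex
  exact (div_eq_iff hne).2 key

theorem exists_forall_abs_sub_lt_of_mem_nhds {V : Set SL(2, ℝ)} (hV : V ∈ 𝓝 (1 : SL(2, ℝ))) :
    ∃ ε > 0, ∀ g : SL(2, ℝ), (∀ i j, |g i j - (1 : SL(2, ℝ)) i j| < ε) → g ∈ V := by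
  obtain ⟨U, hU, hUV⟩ := (mem_nhds_induced _ _ _).1 hV
  obtain ⟨ε, hε, hb⟩ := (Metric.mem_nhds_iff (α := Fin 2 → Fin 2 → ℝ)).1 hU
  refine ⟨ε, hε, fun g hg => hUV (hb ?_)⟩
  refine (dist_pi_lt_iff (X := fun _ : Fin 2 => Fin 2 → ℝ) hε).2 ?_
  intro i
  rw [dist_pi_lt_iff hε]
  intro j
  exact hg i j

/-! ### Lifting p₁(Γ) and the kernel of p₂ to `SL(2, ℝ)` -/

section Lifts

variable {n : ℕ} {r : WithTop ℕ∞} {F : Type*} [TopologicalSpace F]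
  [ChartedSpace (EuclideanSpace ℝ (Fin n)) F]
  (Γ : Subgroup (PSL(2, ℝ) × (F ≃ₘ^r⟮𝓡 n, 𝓡 n⟯ F)))

/-- The preimage in `SL(2, ℝ)` of the projection of `Γ` to `PSL(2, ℝ)`. -/
noncomputable def liftFst : Subgroup SL(2, ℝ) :=
  (Γ.map (MonoidHom.fst PSL(2, ℝ) (F ≃ₘ^r⟮𝓡 n, 𝓡 n⟯ F))).comap (QuotientGroup.mk' _)

/-- The preimage in `SL(2, ℝ)` of the kernel of the projection of `Γ` to the diffeomorphisms. -/
noncomputable def liftKer : Subgroup SL(2, ℝ) :=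
  Γ.comap ((MonoidHom.inl PSL(2, ℝ) (F ≃ₘ^r⟮𝓡 n, 𝓡 n⟯ F)).comp (QuotientGroup.mk' _))

variable {Γ}

theorem mem_liftFst {g : SL(2, ℝ)} :
    g ∈ liftFst Γ ↔ ∃ d : F ≃ₘ^r⟮𝓡 n, 𝓡 n⟯ F, ((QuotientGroup.mk g : PSL(2, ℝ)), d) ∈ Γ := by
  constructor
  · rintro ⟨⟨p, d⟩, h, e⟩
    exact ⟨d, by rwa [show (QuotientGroup.mk g : PSL(2, ℝ)) = p from e.symm]⟩
  · rintro ⟨d, h⟩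
    exact ⟨_, h, rfl⟩

theorem mem_liftKer {g : SL(2, ℝ)} :
    g ∈ liftKer Γ ↔ ((QuotientGroup.mk g : PSL(2, ℝ)), (1 : F ≃ₘ^r⟮𝓡 n, 𝓡 n⟯ F)) ∈ Γ := Iff.rfl

instance : ContinuousConstSMul Γ (ℍ × F) where
  continuous_const_smul γ :=
    ((continuous_const_smul γ.1.1).comp continuous_fst).prodMk
      (γ.1.2.continuous.comp continuous_snd)

theorem exists_smul_eq_of_mk_eq {Y : Type*} [MulAction PSL(2, ℝ) Y] {x x' : Y × F}
    (h : (Quotient.mk'' x : MulAction.orbitRel.Quotient Γ (Y × F)) = Quotient.mk'' x') :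
    ∃ γ ∈ Γ, γ • x = x' := by
  obtain ⟨γ, hγ⟩ := Quotient.exact h.symm
  exact ⟨γ.1, γ.2, hγ⟩

/-- Relatively compact open sets exhaust ℍ; the image in `M` of one of them times `F` is already all
of `M`, so Γ brings every f • i into it. -/
theorem bounded_liftFst [Nonempty F] (hM : CompactSpace (FoliatedSpace Γ)) :
    ∃ R : ℝ, ∀ f : SL(2, ℝ), ∃ γ ∈ liftFst Γ, ∀ i j, |(γ * f) i j| ≤ R := by
  let V : ℕ → Set ℍ := fun k => {z | ‖(z : ℂ)‖ < k + 1 ∧ 1 / ((k : ℝ) + 1) < z.im}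
  have hVo : ∀ k, IsOpen (V k) := fun k =>
    (isOpen_lt UpperHalfPlane.continuous_coe.norm continuous_const).inter
      (isOpen_lt continuous_const UpperHalfPlane.continuous_im)
  have hVm : Monotone V := by
    intro k l hkl z hz
    have hkl' : (k : ℝ) ≤ l := by exact_mod_cast hkl
    refine ⟨hz.1.trans_le (by linarith), lt_of_le_of_lt ?_ hz.2⟩
    exact one_div_le_one_div_of_le (by positivity) (by linarith)
  have hVc : ∀ z : ℍ, ∃ k, z ∈ V k := by
    intro z
    obtain ⟨k, hk⟩ := exists_nat_gt (max ‖(z : ℂ)‖ (1 / z.im))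
    rw [max_lt_iff] at hk
    refine ⟨k, by linarith, ?_⟩
    rw [one_div_lt (by positivity) z.im_pos]
    linarith
  let O : ℕ → Set (FoliatedSpace Γ) := fun k => Quotient.mk'' '' (V k ×ˢ univ)
  have hOo : ∀ k, IsOpen (O k) := fun k =>
    isOpenMap_quotient_mk'_mul (Γ := Γ) _ ((hVo k).prod isOpen_univ)
  obtain ⟨k, hk⟩ := isCompact_univ.elim_directed_cover O hOo (by
    rintro ⟨z, y⟩ -
    obtain ⟨k, hk⟩ := hVc z
    exact mem_iUnion.2 ⟨k, (z, y), ⟨hk, trivial⟩, rfl⟩)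
    (Monotone.directed_le fun k l hkl => image_mono (prod_mono (hVm hkl) subset_rfl))
  obtain ⟨y⟩ := ‹Nonempty F›
  refine ⟨2 * ((k : ℝ) + 1) ^ 2, fun f => ?_⟩
  obtain ⟨⟨z, y'⟩, ⟨hz, -⟩, he⟩ := hk (mem_univ (Quotient.mk'' (f • UpperHalfPlane.I, y)))
  obtain ⟨⟨p, d⟩, hγ, h⟩ := exists_smul_eq_of_mk_eq he.symm
  obtain ⟨g, rfl⟩ := QuotientGroup.mk_surjective p
  have h1 : (g * f) • UpperHalfPlane.I = z := by
    rw [mul_smul]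
    exact congrArg Prod.fst h
  rw [← h1] at hz
  exact ⟨g, mem_liftFst.2 ⟨d, hγ⟩, abs_apply_le_of_smul_I (by linarith [k.cast_nonneg (α := ℝ)])
    hz.1 hz.2⟩

/-- Elements (g, 1) preserve ℍ × {y}, so proper discontinuity, applied to a ball in this slice,
leaves only finitely many g, two lifts per class, moving i by at most 1. -/
theorem discrete_liftKer [Nonempty F] (hpd : ProperlyDiscontinuousSMul Γ (ℍ × F)) :
    ∃ ε > 0, ∀ g ∈ liftKer Γ, (∀ i j, |g i j - (1 : SL(2, ℝ)) i j| < ε) → g = 1 := by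
  obtain ⟨y⟩ := ‹Nonempty F›
  have hK : IsCompact (Metric.closedBall UpperHalfPlane.I 1 ×ˢ {y} : Set (ℍ × F)) :=
    (isCompact_closedBall _ _).prod isCompact_singleton
  have hfin := hpd.finite_disjoint_inter_image hK hK
  have hfin' : {g : SL(2, ℝ) | g ∈ liftKer Γ ∧
      g • UpperHalfPlane.I ∈ Metric.closedBall UpperHalfPlane.I 1}.Finite := by
    refine ((hfin.image fun γ : Γ => γ.1.1).preimage' (f := (QuotientGroup.mk : SL(2, ℝ) → PSL(2, ℝ)))
      fun p _ => ?_).subset ?_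
    · obtain ⟨g, rfl⟩ := QuotientGroup.mk_surjective p
      refine (toFinite {g, -g}).subset fun h hh => ?_
      exact eq_or_eq_neg_of_mk_eq (Eq.symm hh)
    · rintro g ⟨hg, hgb⟩
      refine ⟨⟨_, hg⟩, ⟨(g • UpperHalfPlane.I, y), ⟨(UpperHalfPlane.I, y), ?_, rfl⟩, hgb, rfl⟩, rfl⟩
      exact ⟨Metric.mem_closedBall_self zero_le_one, rfl⟩
  have hV : ({g : SL(2, ℝ) | g • UpperHalfPlane.I ∈ Metric.ball UpperHalfPlane.I 1} ∩
      ({g : SL(2, ℝ) | g ∈ liftKer Γ ∧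
        g • UpperHalfPlane.I ∈ Metric.closedBall UpperHalfPlane.I 1} \ {1})ᶜ) ∈ 𝓝 (1 : SL(2, ℝ)) := by
    refine inter_mem ?_ ((hfin'.sdiff).isClosed.isOpen_compl.mem_nhds (by simp))
    refine (Metric.isOpen_ball.preimage
      (f := fun g : SL(2, ℝ) => g • UpperHalfPlane.I) (by fun_prop)).mem_nhds ?_
    simp
  obtain ⟨ε, hε, h⟩ := exists_forall_abs_sub_lt_of_mem_nhds hV
  refine ⟨ε, hε, fun g hg hgε => ?_⟩
  obtain ⟨h1, h2⟩ := h g hgε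
  by_contra hne
  exact h2 ⟨⟨hg, Metric.ball_subset_closedBall h1⟩, hne⟩

/-- An elliptic g in the kernel would fix some z in ℍ, hence (g, 1) would fix (z, y), against
freeness. -/
theorem cocompactNormalPair [Nonempty F] (hfree : ∀ (γ : Γ) (x : ℍ × F), γ • x = x → γ = 1)
    (hpd : ProperlyDiscontinuousSMul Γ (ℍ × F)) (hM : CompactSpace (FoliatedSpace Γ)) :
    CocompactNormalPair (liftFst Γ) (liftKer Γ) where
  bounded := bounded_liftFst hM
  le g hg := mem_liftFst.2 ⟨1, hg⟩
  normal γ hγ g hg := by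
    obtain ⟨d, hd⟩ := mem_liftFst.1 hγ
    have := Γ.mul_mem (Γ.mul_mem hd (mem_liftKer.1 hg)) (Γ.inv_mem hd)
    rw [mem_liftKer]
    convert this using 1
    ext1
    · rfl
    · simp
  discrete := discrete_liftKer hpd
  two_le_abs_trace g hg := by
    by_contra! hlt
    obtain ⟨z, hz⟩ := exists_smul_eq_of_abs_trace_lt g hlt
    obtain ⟨y⟩ := ‹Nonempty F›
    have h1 := hfree ⟨_, mem_liftKer.1 hg⟩ (z, y) (Prod.ext hz rfl)
    have h2 : (QuotientGroup.mk g : PSL(2, ℝ)) = 1 := congrArg (fun γ : Γ => γ.1.1) h1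
    rcases eq_one_or_eq_neg_one h2 with rfl | rfl
    · norm_num at hlt
    · norm_num at hlt
  neg_one_mem := by
    rw [mem_liftKer, mk_neg_one]
    exact Γ.one_mem

theorem exists_mem_liftKer_ne
    (hp₂ : ¬ Set.InjOn (MonoidHom.snd PSL(2, ℝ) (F ≃ₘ^r⟮𝓡 n, 𝓡 n⟯ F)) (Γ : Set _)) :
    ∃ g ∈ liftKer Γ, g ≠ 1 ∧ g ≠ -1 := by
  simp only [InjOn, not_forall] at hp₂
  obtain ⟨γ, hγ, δ, hδ, he, hne⟩ := hp₂
  obtain ⟨g, hg⟩ := QuotientGroup.mk_surjective (γ * δ⁻¹).1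
  have h2 : (γ * δ⁻¹).2 = 1 := mul_inv_eq_one.2 he
  have hg1 : (QuotientGroup.mk g : PSL(2, ℝ)) ≠ 1 := by
    intro h
    rw [hg] at h
    exact hne (mul_inv_eq_one.1 (Prod.ext h h2))
  refine ⟨g, ?_, ?_, ?_⟩
  · rw [mem_liftKer, hg, ← h2]
    exact Γ.mul_mem hγ (Γ.inv_mem hδ)
  · rintro rfl
    exact hg1 rfl
  · rintro rfl
    exact hg1 mk_neg_one

/-- If the foliation is minimal then `Γ` acts minimally on `F`. -/
theorem dense_orbit_of_isMinimalFoliation (hmin : IsMinimalFoliation Γ) (y : F) :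
    Dense {y' : F | ∃ γ ∈ Γ, γ.2 • y = y'} := by
  rw [dense_iff_inter_open]
  rintro O hO ⟨o, ho⟩
  have hOo : IsOpen ((Quotient.mk'' : ℍ × F → FoliatedSpace Γ) '' (univ ×ˢ O)) :=
    isOpenMap_quotient_mk'_mul (Γ := Γ) _ (isOpen_univ.prod hO)
  obtain ⟨_, ⟨⟨z', o'⟩, ⟨-, ho'⟩, he⟩, z, rfl⟩ :=
    (dense_iff_inter_open.1 (hmin y)) _ hOo ⟨_, (UpperHalfPlane.I, o), ⟨trivial, ho⟩, rfl⟩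
  obtain ⟨γ, hγ, h⟩ := exists_smul_eq_of_mk_eq he.symm
  exact ⟨o', ho', γ, hγ, congrArg Prod.snd h⟩

end Lifts

/-! ### From closed `U`-stable sets to subsets of the punctured plane times `F` -/

theorem continuous_colMat : Continuous fun v : {v : ℝ × ℝ // v ≠ 0} => colMat v.1 v.2 := by
  have hne : ∀ v : {v : ℝ × ℝ // v ≠ 0}, v.1.1 ^ 2 + v.1.2 ^ 2 ≠ 0 := fun v h =>
    v.2 (Prod.ext (by simp; nlinarith) (by simp; nlinarith))
  refine continuous_induced_rng.2 (continuous_matrix fun i j => ?_)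
  fin_cases i <;> fin_cases j <;> simp [colMat] <;> fun_prop (disch := exact hne _)

/-- A closed subset of the punctured plane becomes closed in the plane once the origin is added; the
vacuous condition at 0 does this. -/
theorem isClosed_of_isClosed_subtype {A : Set {v : ℝ × ℝ // v ≠ 0}} (hA : IsClosed A) :
    IsClosed {v : ℝ × ℝ | ∀ hv : v ≠ 0, (⟨v, hv⟩ : {v : ℝ × ℝ // v ≠ 0}) ∈ A} := by
  rw [← isOpen_compl_iff]
  convert isOpen_ne.isOpenMap_subtype_val _ hA.isOpen_compl using 1
  ext v
  simp

/-- Equal first columns mean that g⁻¹h fixes e₁, so it is upper unipotent. -/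
theorem mk_inv_mul_mem_horocyclicSubgroup {g h : SL(2, ℝ)} (h0 : g 0 0 = h 0 0)
    (h1 : g 1 0 = h 1 0) : (QuotientGroup.mk (g⁻¹ * h) : PSL(2, ℝ)) ∈ horocyclicSubgroup := by
  refine ⟨g⁻¹ * h, (g⁻¹ * h) 0 1, ?_, rfl⟩
  obtain ⟨k1, k2, k3, k4⟩ := sl_inv_apply g
  have hg := sl_det g
  have hh := sl_det h
  ext i j
  fin_cases i <;> fin_cases j
  · change (g⁻¹ * h) 0 0 = 1
    rw [sl_mul_apply, k1, k2, ← h0, ← h1]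
    linarith
  · rfl
  · change (g⁻¹ * h) 1 0 = 0
    rw [sl_mul_apply, k3, k4, ← h0, ← h1]
    ring
  · change (g⁻¹ * h) 1 1 = 1
    rw [sl_mul_apply, k3, k4, h0, h1]
    linarith

section Closure

variable {n : ℕ} {r : WithTop ℕ∞} {F : Type*} [TopologicalSpace F]
  [ChartedSpace (EuclideanSpace ℝ (Fin n)) F]
  {Γ : Subgroup (PSL(2, ℝ) × (F ≃ₘ^r⟮𝓡 n, 𝓡 n⟯ F))}

theorem continuous_rightAction (a : PSL(2, ℝ)ᵐᵒᵖ) :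
    Continuous fun x : UnitTangentSpace Γ => a • x :=
  Continuous.quotient_map' (s := MulAction.orbitRel Γ _) (t := MulAction.orbitRel Γ _)
    (f := fun x : PSL(2, ℝ) × F => (x.1 * a.unop, x.2)) (by fun_prop) (by
      rintro _ x ⟨γ, rfl⟩
      exact ⟨γ, Prod.ext (mul_assoc _ _ _).symm rfl⟩)

theorem continuous_unitTangentSpace_mk :
    Continuous fun x : SL(2, ℝ) × F =>
      (Quotient.mk'' ((QuotientGroup.mk x.1 : PSL(2, ℝ)), x.2) : UnitTangentSpace Γ) :=
  continuous_quotient_mk'.comp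
    ((QuotientGroup.continuous_mk.comp continuous_fst).prodMk continuous_snd)

variable [CompactSpace F]

/-- A nonempty closed subset of `UnitTangentSpace Γ` stable under the horocyclic subgroup is
everything. -/
theorem eq_univ_of_isClosed_of_stable (hfree : ∀ (γ : Γ) (x : ℍ × F), γ • x = x → γ = 1)
    (hpd : ProperlyDiscontinuousSMul Γ (ℍ × F)) (hM : CompactSpace (FoliatedSpace Γ))
    (hmin : IsMinimalFoliation Γ)
    (hp₂ : ¬ Set.InjOn (MonoidHom.snd PSL(2, ℝ) (F ≃ₘ^r⟮𝓡 n, 𝓡 n⟯ F)) (Γ : Set _))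
    {C : Set (UnitTangentSpace Γ)} (hC : IsClosed C) (hne : C.Nonempty)
    (hU : ∀ u ∈ horocyclicSubgroup, ∀ x ∈ C, MulOpposite.op u • x ∈ C) : C = univ := by
  obtain ⟨E, hE⟩ : ∃ E : Set (SL(2, ℝ) × F), E = (fun x : SL(2, ℝ) × F =>
    (Quotient.mk'' ((QuotientGroup.mk x.1 : PSL(2, ℝ)), x.2) : UnitTangentSpace Γ)) ⁻¹' C := ⟨_, rfl⟩
  have hEcl : IsClosed E := hE ▸ hC.preimage continuous_unitTangentSpace_mk
  have hmemE : ∀ g y, (g, y) ∈ E ↔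
      (Quotient.mk'' ((QuotientGroup.mk g : PSL(2, ℝ)), y) : UnitTangentSpace Γ) ∈ C := by
    intro g y
    rw [hE]
    rfl
  have hEcol : ∀ {g h : SL(2, ℝ)} {y : F}, g 0 0 = h 0 0 → g 1 0 = h 1 0 → (g, y) ∈ E →
      (h, y) ∈ E := by
    intro g h y h0 h1 hg
    rw [hmemE] at hg ⊢
    have := hU _ (mk_inv_mul_mem_horocyclicSubgroup h0 h1) _ hg
    convert this using 1
    refine congrArg Quotient.mk'' (Prod.ext ?_ rfl)
    change _ = QuotientGroup.mk g * QuotientGroup.mk (g⁻¹ * h)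
    rw [← QuotientGroup.mk_mul, mul_inv_cancel_left]
  have hEΓ : ∀ {γ g : SL(2, ℝ)} {d : F ≃ₘ^r⟮𝓡 n, 𝓡 n⟯ F} {y : F},
      ((QuotientGroup.mk γ : PSL(2, ℝ)), d) ∈ Γ → (g, y) ∈ E → (γ * g, d • y) ∈ E := by
    intro γ g d y hγ hg
    rw [hmemE] at hg ⊢
    convert hg using 1
    exact Quotient.sound ⟨⟨_, hγ⟩, rfl⟩
  obtain ⟨E', hE'⟩ : ∃ E' : Set ({v : ℝ × ℝ // v ≠ 0} × F),
    E' = (fun x => (colMat x.1.1 x.1.2, x.2)) ⁻¹' E := ⟨_, rfl⟩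
  have hmemE' : ∀ {v : ℝ × ℝ} (hv : v ≠ 0) (y : F), (⟨v, hv⟩, y) ∈ E' ↔ (colMat v hv, y) ∈ E := by
    intro v hv y
    rw [hE']
    rfl
  have hE'cl : IsClosed E' := hE' ▸ hEcl.preimage
    ((continuous_colMat.comp continuous_fst).prodMk continuous_snd)
  have hE'Γ : ∀ {γ : SL(2, ℝ)} {d : F ≃ₘ^r⟮𝓡 n, 𝓡 n⟯ F} {v : ℝ × ℝ} {y : F} (hv : v ≠ 0),
      ((QuotientGroup.mk γ : PSL(2, ℝ)), d) ∈ Γ → (⟨v, hv⟩, y) ∈ E' →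
      (⟨linAct γ v, linAct_ne_zero γ hv⟩, d • y) ∈ E' := by
    intro γ d v y hv hγ h
    rw [hmemE'] at h ⊢
    obtain ⟨c1, c2⟩ := colMat_apply v hv
    obtain ⟨b1, b2⟩ := colMat_apply _ (linAct_ne_zero γ hv)
    refine hEcol ?_ ?_ (hEΓ hγ h)
    · rw [sl_mul_apply, c1, c2, b1, linAct]
    · rw [sl_mul_apply, c1, c2, b2, linAct]
  obtain ⟨⟨p, y₀⟩, hx₀⟩ := Quotient.mk''_surjective.nonempty_preimage.2 hne
  obtain ⟨g₀, rfl⟩ := QuotientGroup.mk_surjective p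
  have : Nonempty F := ⟨y₀⟩
  have hcolne : ∀ g : SL(2, ℝ), ((g 0 0, g 1 0) : ℝ × ℝ) ≠ 0 := by
    intro g h
    rw [Prod.mk_eq_zero] at h
    have := sl_det g
    rw [h.1, h.2] at this
    norm_num at this
  have hEE' : ∀ g y, (g, y) ∈ E ↔ (⟨_, hcolne g⟩, y) ∈ E' := by
    intro g y
    rw [hmemE']
    obtain ⟨c1, c2⟩ := colMat_apply _ (hcolne g)
    exact ⟨hEcol c1.symm c2.symm, hEcol c1 c2⟩
  obtain ⟨W, hW0, hWΛ, hWN⟩ := (cocompactNormalPair hfree hpd hM).exists_eigenvectors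
    (exists_mem_liftKer_ne hp₂)
  -- The set P is the projection of `E'`, closed because `F` is compact, together with the origin.
  obtain ⟨w, hwW, hwP⟩ := hWΛ _
    (isClosed_of_isClosed_subtype (isClosedMap_fst_of_compactSpace _ hE'cl)) (by
      intro γ hγ v hv hv'
      obtain ⟨d, hd⟩ := mem_liftFst.1 hγ
      have hv0 : v ≠ 0 := by
        rintro rfl
        exact hv' (linAct_zero γ)
      obtain ⟨⟨_, y⟩, h, rfl⟩ := hv hv0
      exact ⟨_, hE'Γ hv0 hd h, rfl⟩) _
    (fun _ => ⟨_, (hEE' g₀ y₀).1 ((hmemE _ _).2 hx₀), rfl⟩) (hcolne g₀)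
  have hw0 : w ≠ 0 := fun h => hW0 (h ▸ hwW)
  obtain ⟨⟨_, y⟩, hwy, rfl⟩ := hwP hw0
  have hfib : IsClosed {v : {v : ℝ × ℝ // v ≠ 0} | (v, y) ∈ E'} :=
    hE'cl.preimage (by fun_prop)
  -- Elements of `N` lift to (g, 1) in Γ, so they preserve the fibre over the single point y.
  have hD := hWN _ (isClosed_of_isClosed_subtype hfib) (by
    intro g hg v hv hv'
    have hv0 : v ≠ 0 := by
      rintro rfl
      exact hv' (linAct_zero g)
    exact hE'Γ hv0 (mem_liftKer.1 hg) (hv hv0)) _ hwW (fun _ => hwy)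
  have hy : ∀ (v : ℝ × ℝ) (hv : v ≠ 0), (⟨v, hv⟩, y) ∈ E' := fun v hv => by
    have : v ∈ {v : ℝ × ℝ | ∀ hv : v ≠ 0, (⟨v, hv⟩ : {v : ℝ × ℝ // v ≠ 0}) ∈
      {v : {v : ℝ × ℝ // v ≠ 0} | (v, y) ∈ E'}} := hD ▸ mem_univ v
    exact this hv
  have hall : ∀ (v : ℝ × ℝ) (hv : v ≠ 0) (y' : F), (⟨v, hv⟩, y') ∈ E' := by
    intro v hv y'
    have hcl : IsClosed {y' : F | (⟨v, hv⟩, y') ∈ E'} := hE'cl.preimage (by fun_prop)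
    refine hcl.closure_subset_iff.2 ?_ (dense_orbit_of_isMinimalFoliation hmin y y')
    rintro _ ⟨⟨p, d⟩, hγ, rfl⟩
    obtain ⟨γ, rfl⟩ := QuotientGroup.mk_surjective p
    -- The fibre over y is full, so it contains γ⁻¹v; applying (γ, d) gives v over d • y, and such
    -- points are dense in `F`.
    have := hE'Γ (linAct_ne_zero γ⁻¹ hv) hγ (hy _ _)
    rw [mem_ofPred_eq]
    simpa only [linAct_linAct_inv] using this
  refine eq_univ_of_forall fun x => ?_
  induction x using Quotient.inductionOn' with
  | h x =>
    obtain ⟨p, y'⟩ := x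
    obtain ⟨g, rfl⟩ := QuotientGroup.mk_surjective p
    exact (hmemE _ _).1 ((hEE' g y').2 (hall _ _ _))

end Closure

end HorocycleFoliation

theorem mainTheorem11 (n : ℕ) (r : WithTop ℕ∞) (F : Type*) [TopologicalSpace F] [T2Space F]
    [ChartedSpace (EuclideanSpace ℝ (Fin n)) F] [IsManifold (𝓡 n) r F] [CompactSpace F]
    (Γ : Subgroup (PSL(2, ℝ) × (F ≃ₘ^r⟮𝓡 n, 𝓡 n⟯ F)))
    -- `Γ` acts freely and properly discontinuously on `ℍ × F`, with compact quotient `M`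
    (hfree : ∀ (γ : Γ) (x : ℍ × F), γ • x = x → γ = 1)
    (hpd : ProperlyDiscontinuousSMul Γ (ℍ × F))
    (hM : CompactSpace (HorocycleFoliation.FoliatedSpace Γ))
    (hmin : HorocycleFoliation.IsMinimalFoliation Γ)
    (htf : ∀ γ : Γ, IsOfFinOrder γ → γ = 1)
    (hsolv : ¬ Group.IsSolvable (Γ.map (MonoidHom.fst PSL(2, ℝ) (F ≃ₘ^r⟮𝓡 n, 𝓡 n⟯ F))))
    (hp₂ : ¬ Set.InjOn (MonoidHom.snd PSL(2, ℝ) (F ≃ₘ^r⟮𝓡 n, 𝓡 n⟯ F)) (Γ : Set _)) :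
    MulAction.IsMinimal HorocycleFoliation.horocyclicSubgroup.op
      (HorocycleFoliation.UnitTangentSpace Γ) := by
  refine ⟨fun x => dense_iff_closure_eq.2 ?_⟩
  refine HorocycleFoliation.eq_univ_of_isClosed_of_stable hfree hpd hM hmin hp₂ isClosed_closure
    ⟨x, subset_closure (MulAction.mem_orbit_self x)⟩ fun u hu z hz => ?_
  refine map_mem_closure (HorocycleFoliation.continuous_rightAction (MulOpposite.op u)) hz ?_
  intro w hw
  exact MulAction.mem_orbit_of_mem_orbit
    (⟨MulOpposite.op u, hu⟩ : HorocycleFoliation.horocyclicSubgroup.op) hw
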